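/- Let $k$ be a field and let $H$ be a finite-dimensional quasi-Hopf algebra over $k$ with invertible antipode, i.e. a unital associative $k$-algebra with unital algebra morphisms $\Delta: H\to H\otimes H$, $\varepsilon: H\to k$, an invertible element $\phi=\sum X\otimes Y\otimes Z\in H^{\otimes 3}$ (write $\phi^{-1}=\sum\bar X\otimes\bar Y\otimes\bar Z$) such that $$(\mathrm{id}\otimes\Delta)(\Delta(a))\,\phi=\phi\,(\Delta\otimes\mathrm{id})(\Delta(a)),\qquad (\varepsilon\otimes\mathrm{id})\Delta=\mathrm{id}=(\mathrm{id}\otimes\varepsilon)\Delta,\qquad (\mathrm{id}\otimes\varepsilon\otimes\mathrm{id})(\phi)=1\otimes1,$$ $$(\mathrm{id}\otimes\mathrm{id}\otimes\Delta)(\phi)\,(\Delta\otimes\mathrm{id}\otimes\mathrm{id})(\phi)=(1\otimes\phi)\,(\mathrm{id}\otimes\Delta\otimes\mathrm{id})(\phi)\,(\phi\otimes1),$$ a bijective unital algebra antimorphism $S:H\to H$, and elements $\alpha,\beta\in H$ with $S(a_{(1)})\alpha a_{(2)}=\varepsilon(a)\alpha$, $a_{(1)}\beta S(a_{(2)})=\varepsilon(a)\beta$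 for all $a\in H$, and $\sum X\beta S(Y)\alpha Z=1=\sum S(\bar X)\alpha\bar Y\beta S(\bar Z)$. Here $\Delta(a)=a_{(1)}\otimes a_{(2)}$ (summation suppressed), $\Delta^{op}(a)=a_{(2)}\otimes a_{(1)}$, and $(x\otimes y)^{21}=y\otimes x$. Put $q_R=\sum X\otimes S^{-1}(\alpha Z)Y$ and $p_R=\sum\bar X\otimes\bar Y\beta S(\bar Z)$. With $\sum T\otimes U'\otimes V'\otimes W=(1\otimes\phi^{-1})(\mathrm{id}\otimes\mathrm{id}\otimes\Delta)(\phi)$ put $\gamma=\sum(S(U')\otimes S(T))(\alpha\otimes\alpha)(V'\otimes W)$ and $$f=\sum (S\otimes S)(\Delta^{op}(\bar X))\,\gamma\,\Delta(\bar Y\beta S(\bar Z)).$$ Put $h=(S^{-1}\otimes S^{-1})(f^{21})$. The element $f\in H\otimes H$ is invertible; put $U=f^{-1}(S\otimes S)(q_R^{21})$, $V=(S^{-1}\otimes S^{-1})(p_R^{21})\,h$ and $\bar\Delta(a)=V\Delta(a)U$ for $a\in H$. Let $H^*=\mathrm{Hom}_k(H,k)$ be the dual space with the actions $(a\cdot\psi\cdot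 b)(m)=\psi(S^{-1}(a)\,m\,S(b))$ of $H$ and with the coaction $\rho:H^*\to H^*\otimes H$, $\rho(\psi)=\psi_{(0)}\otimes\psi_{(1)}$, determined by $\psi_{(0)}(m)\,\psi_{(1)}=(\mathrm{id}\otimes\psi)(\bar\Delta(m))$ for all $m\in H$. Writing $q_R=q^1\otimes q^2$, put $E(\psi)=q^1\cdot\psi_{(0)}\cdot\beta S(q^2\psi_{(1)})$ for $\psi\in H^*$. A left cointegral on $H$ is an element of $E(H^*)$. A right integral in $H$ is an element $r\in H$ with $ra=\varepsilon(a)r$ for all $a\in H$. For $\lambda\in H^*$ let $\mathcal F_\lambda:H\to H^*$ be the map $\mathcal F_\lambda(a)(b)=\lambda(b\,S(a))$. Let $\lambda$ be a nonzero left cointegral on $H$. Then there is a unique right integral $r\in H$ with $\lambda(r)=1$. With this $r$, the map $\mathcal F_\lambda$ is bijective with inverse $$\mathcal F_\lambda^{-1}(\psi)=(\mathrm{id}\otimes\psi)(\bar\Delta(r)),\qquad \psi\in H^*,$$ and there is a unique element $Q_\lambda=\sum_i u_i\otimes v_i\in H\otimes H$ (the Frobenius basis of $\lambda$) satisfying $\sum_i\lambda(au_i)v_i=a=\sum_i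 u_i\lambda(v_ia)$ for all $a\in H$; it is given by $$Q_\lambda=(S\otimes\mathrm{id})(\bar\Delta(r)).$$ -/

import Mathlib

open scoped TensorProduct

noncomputable section

/-- A quasi-Hopf algebra structure on a unital associative algebra `H` over a field `k`, with
invertible antipode.  Triple and quadruple tensor powers are bracketed to the right. -/
structure QuasiHopf (k H : Type*) [Field k] [Ring H] [Algebra k H] where
  /-- the coproduct `Δ` -/
  comul : H →ₐ[k] H ⊗[k] H
  /-- the counit `ε` -/
  counit : H →ₐ[k] k
  /-- the reassociator `φ`, an invertible element of `H ⊗ H ⊗ H` -/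
  reassoc : (H ⊗[k] (H ⊗[k] H))ˣ
  /-- `(id ⊗ Δ)(Δ(a)) φ = φ (Δ ⊗ id)(Δ(a))` -/
  quasi_coassoc : ∀ a : H,
    Algebra.TensorProduct.map (AlgHom.id k H) comul (comul a) * (reassoc : H ⊗[k] (H ⊗[k] H)) =
      (reassoc : H ⊗[k] (H ⊗[k] H)) *
        Algebra.TensorProduct.assoc k k k H H H
          (Algebra.TensorProduct.map comul (AlgHom.id k H) (comul a))
  /-- `(id ⊗ id ⊗ Δ)(φ) (Δ ⊗ id ⊗ id)(φ) = (1 ⊗ φ) (id ⊗ Δ ⊗ id)(φ) (φ ⊗ 1)` -/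
  pentagon :
    Algebra.TensorProduct.map (AlgHom.id k H)
        (Algebra.TensorProduct.map (AlgHom.id k H) comul) (reassoc : H ⊗[k] (H ⊗[k] H)) *
      Algebra.TensorProduct.assoc k k k H H (H ⊗[k] H)
        (Algebra.TensorProduct.map comul (AlgHom.id k (H ⊗[k] H))
          (reassoc : H ⊗[k] (H ⊗[k] H))) =
    ((1 : H) ⊗ₜ[k] (reassoc : H ⊗[k] (H ⊗[k] H))) *
      Algebra.TensorProduct.map (AlgHom.id k H)
        ((Algebra.TensorProduct.assoc k k k H H H).toAlgHom.comp
          (Algebra.TensorProduct.map comul (AlgHom.id k H)))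
        (reassoc : H ⊗[k] (H ⊗[k] H)) *
      Algebra.TensorProduct.map (AlgHom.id k H)
        (Algebra.TensorProduct.assoc k k k H H H).toAlgHom
        (Algebra.TensorProduct.assoc k k k H (H ⊗[k] H) H
          ((reassoc : H ⊗[k] (H ⊗[k] H)) ⊗ₜ[k] (1 : H)))
  /-- `(ε ⊗ id)(Δ(a)) = a` -/
  counit_comul : ∀ a : H,
    Algebra.TensorProduct.lid k H
      (Algebra.TensorProduct.map counit (AlgHom.id k H) (comul a)) = a
  /-- `(id ⊗ ε)(Δ(a)) = a` -/
  comul_counit : ∀ a : H,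
    Algebra.TensorProduct.rid k k H
      (Algebra.TensorProduct.map (AlgHom.id k H) counit (comul a)) = a
  /-- `(id ⊗ ε ⊗ id)(φ) = 1 ⊗ 1` -/
  counit_reassoc :
    Algebra.TensorProduct.map (AlgHom.id k H)
      ((Algebra.TensorProduct.lid k H).toAlgHom.comp
        (Algebra.TensorProduct.map counit (AlgHom.id k H)))
      (reassoc : H ⊗[k] (H ⊗[k] H)) = 1
  /-- the (invertible) antipode `S` -/
  antipode : H ≃ₗ[k] H
  antipode_one : antipode 1 = 1
  antipode_mul : ∀ a b : H, antipode (a * b) = antipode b * antipode a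
  /-- the element `α` -/
  α : H
  /-- the element `β` -/
  β : H
  /-- `S(a₁) α a₂ = ε(a) α` -/
  antipode_α : ∀ a : H,
    LinearMap.mul' k H
      (TensorProduct.map antipode.toLinearMap (LinearMap.mulLeft k α) (comul a)) = counit a • α
  /-- `a₁ β S(a₂) = ε(a) β` -/
  β_antipode : ∀ a : H,
    LinearMap.mul' k H
      (TensorProduct.map LinearMap.id (LinearMap.mulLeft k β ∘ₗ antipode.toLinearMap)
        (comul a)) = counit a • β
  /-- `X β S(Y) α Z = 1`, where `φ = X ⊗ Y ⊗ Z` -/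
  reassoc_antipode :
    LinearMap.mul' k H
      (TensorProduct.map LinearMap.id
        (LinearMap.mulLeft k β ∘ₗ LinearMap.mul' k H ∘ₗ
          TensorProduct.map antipode.toLinearMap (LinearMap.mulLeft k α))
        (reassoc : H ⊗[k] (H ⊗[k] H))) = 1
  /-- `S(X) α Y β S(Z) = 1`, where `φ⁻¹ = X ⊗ Y ⊗ Z` -/
  reassoc_inv_antipode :
    LinearMap.mul' k H
      (TensorProduct.map antipode.toLinearMap
        (LinearMap.mulLeft k α ∘ₗ LinearMap.mul' k H ∘ₗ
          TensorProduct.map LinearMap.id (LinearMap.mulLeft k β ∘ₗ antipode.toLinearMap))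
        ((reassoc⁻¹ : (H ⊗[k] (H ⊗[k] H))ˣ) : H ⊗[k] (H ⊗[k] H))) = 1

/-- `(id ⊗ ψ)(x)` for `x ∈ H ⊗ H` and a functional `ψ` on `H`. -/
def sliceRight {k H : Type*} [Field k] [Ring H] [Algebra k H] (ψ : Module.Dual k H) :
    H ⊗[k] H →ₗ[k] H :=
  (TensorProduct.rid k H).toLinearMap ∘ₗ TensorProduct.map LinearMap.id ψ

/-- `(ψ ⊗ id)(x)` for `x ∈ H ⊗ H` and a functional `ψ` on `H`. -/
def sliceLeft {k H : Type*} [Field k] [Ring H] [Algebra k H] (ψ : Module.Dual k H) :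
    H ⊗[k] H →ₗ[k] H :=
  (TensorProduct.lid k H).toLinearMap ∘ₗ TensorProduct.map ψ LinearMap.id

/-- `Q = ∑ uᵢ ⊗ vᵢ` is a Frobenius basis of the functional `lam`:
`∑ lam(a uᵢ) vᵢ = a = ∑ uᵢ lam(vᵢ a)` for all `a`. -/
def IsFrobeniusBasis {k H : Type*} [Field k] [Ring H] [Algebra k H] (lam : Module.Dual k H)
    (Q : H ⊗[k] H) : Prop :=
  ∀ a : H, sliceLeft (lam ∘ₗ LinearMap.mulLeft k a) Q = a ∧
    sliceRight (lam ∘ₗ LinearMap.mulRight k a) Q = a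

namespace QuasiHopf

variable {k H : Type*} [Field k] [Ring H] [Algebra k H] (A : QuasiHopf k H)

/-- The antipode as a linear map. -/
def S : H →ₗ[k] H := A.antipode.toLinearMap

/-- The inverse of the antipode as a linear map. -/
def Sinv : H →ₗ[k] H := A.antipode.symm.toLinearMap

/-- The reassociator `φ`. -/
def φ : H ⊗[k] (H ⊗[k] H) := (A.reassoc : H ⊗[k] (H ⊗[k] H))

/-- The inverse reassociator `φ⁻¹`. -/
def φinv : H ⊗[k] (H ⊗[k] H) :=
  ((A.reassoc⁻¹ : (H ⊗[k] (H ⊗[k] H))ˣ) : H ⊗[k] (H ⊗[k] H))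

/-- `x ⊗ y ↦ S(y) ⊗ S(x)`, that is, `(S ⊗ S)(t²¹)`. -/
def SSflip : H ⊗[k] H →ₗ[k] H ⊗[k] H :=
  TensorProduct.map A.S A.S ∘ₗ (TensorProduct.comm k H H).toLinearMap

/-- `x ⊗ y ↦ S⁻¹(y) ⊗ S⁻¹(x)`, that is, `(S⁻¹ ⊗ S⁻¹)(t²¹)`. -/
def SinvSinvFlip : H ⊗[k] H →ₗ[k] H ⊗[k] H :=
  TensorProduct.map A.Sinv A.Sinv ∘ₗ (TensorProduct.comm k H H).toLinearMap

/-- `y ⊗ z ↦ y β S(z)`. -/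
def contractβ : H ⊗[k] H →ₗ[k] H :=
  LinearMap.mul' k H ∘ₗ TensorProduct.map LinearMap.id (LinearMap.mulLeft k A.β ∘ₗ A.S)

/-- `y ⊗ z ↦ S⁻¹(α z) y`. -/
def contractα : H ⊗[k] H →ₗ[k] H :=
  LinearMap.mul' k H ∘ₗ TensorProduct.map (A.Sinv ∘ₗ LinearMap.mulLeft k A.α) LinearMap.id ∘ₗ
    (TensorProduct.comm k H H).toLinearMap

/-- `γ = (S(U) ⊗ S(T)) (α ⊗ α) (V ⊗ W)`, where
`T ⊗ U ⊗ V ⊗ W = (1 ⊗ φ⁻¹) (id ⊗ id ⊗ Δ)(φ)`. -/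
def γ : H ⊗[k] H :=
  LinearMap.mul' k (H ⊗[k] H)
    (TensorProduct.map A.SSflip (LinearMap.mulLeft k (A.α ⊗ₜ[k] A.α))
      ((TensorProduct.assoc k H H (H ⊗[k] H)).symm
        (((1 : H) ⊗ₜ[k] A.φinv) *
          Algebra.TensorProduct.map (AlgHom.id k H)
            (Algebra.TensorProduct.map (AlgHom.id k H) A.comul) A.φ)))

/-- Drinfeld's twist `f = (S ⊗ S)(Δᵒᵖ(X)) γ Δ(Y β S(Z))`, where `φ⁻¹ = X ⊗ Y ⊗ Z`. -/
def f : H ⊗[k] H :=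
  LinearMap.mul' k (H ⊗[k] H)
    (TensorProduct.map (A.SSflip ∘ₗ A.comul.toLinearMap)
      (LinearMap.mulLeft k A.γ ∘ₗ A.comul.toLinearMap ∘ₗ A.contractβ) A.φinv)

/-- `h = (S⁻¹ ⊗ S⁻¹)(f²¹)`. -/
def h : H ⊗[k] H := A.SinvSinvFlip A.f

/-- `q_R = X ⊗ S⁻¹(α Z) Y`, where `φ = X ⊗ Y ⊗ Z`. -/
def qR : H ⊗[k] H := TensorProduct.map LinearMap.id A.contractα A.φ

/-- `p_R = X ⊗ Y β S(Z)`, where `φ⁻¹ = X ⊗ Y ⊗ Z`. -/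
def pR : H ⊗[k] H := TensorProduct.map LinearMap.id A.contractβ A.φinv

/-- `U = f⁻¹ (S ⊗ S)(q_R²¹)`.  (`Ring.inverse f` is the two-sided inverse of the element `f`
of the algebra `H ⊗ H`, which is invertible.) -/
def U : H ⊗[k] H := Ring.inverse A.f * A.SSflip A.qR

/-- `V = (S⁻¹ ⊗ S⁻¹)(p_R²¹) h`. -/
def V : H ⊗[k] H := A.SinvSinvFlip A.pR * A.h

/-- The deformed coproduct `Δ̄(a) = V Δ(a) U`. -/
def comulBar : H →ₗ[k] H ⊗[k] H :=
  LinearMap.mulLeft k A.V ∘ₗ LinearMap.mulRight k A.U ∘ₗ A.comul.toLinearMap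

/-- `r` is a right integral: `r a = ε(a) r` for all `a`. -/
def IsRightIntegral (r : H) : Prop := ∀ a : H, r * a = A.counit a • r

/-- The left action of `H` on its dual: `(a · ψ)(m) = ψ(S⁻¹(a) m)`. -/
def dualLeft (a : H) : Module.Dual k H →ₗ[k] Module.Dual k H :=
  Module.Dual.transpose (LinearMap.mulLeft k (A.Sinv a))

/-- The right action of `H` on its dual: `(ψ · b)(m) = ψ(m S(b))`. -/
def dualRight (b : H) : Module.Dual k H →ₗ[k] Module.Dual k H :=
  Module.Dual.transpose (LinearMap.mulRight k (A.S b))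

/-- The right coaction `ρ : H^* → H^* ⊗ H` on the dual of a finite-dimensional `H`: under
`H^* ⊗ H ≅ Hom(H, H)` the element `ρ(ψ)` is the map `m ↦ (id ⊗ ψ)(Δ̄(m))`. -/
def dualCoaction [FiniteDimensional k H] (ψ : Module.Dual k H) : Module.Dual k H ⊗[k] H :=
  (dualTensorHomEquiv k H H).symm (sliceRight ψ ∘ₗ A.comulBar)

/-- For fixed `a, b ∈ H`, the map `ψ ⊗ x ↦ a · ψ · (β S(b x))` on `H^* ⊗ H`. -/
def coinvAux (a b : H) : Module.Dual k H ⊗[k] H →ₗ[k] Module.Dual k H :=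
  TensorProduct.lift (LinearMap.mk₂ k
    (fun ψ x => A.dualRight (A.β * A.S (b * x)) (A.dualLeft a ψ))
    (by intros; simp)
    (by intros; simp)
    (by
      intro ψ x y
      ext m
      simp [dualRight, dualLeft, mul_add, Module.Dual.transpose_apply])
    (by
      intro c ψ x
      ext m
      simp [dualRight, dualLeft, Module.Dual.transpose_apply]))

/-- The map `E : H^* → H^*`, `E(ψ) = q¹ · ψ₀ · β S(q² ψ₁)`, where `q_R = q¹ ⊗ q²` and
`ρ(ψ) = ψ₀ ⊗ ψ₁`. -/
def coinvProj [FiniteDimensional k H] (ψ : Module.Dual k H) : Module.Dual k H :=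
  TensorProduct.lift (LinearMap.mk₂ k
    (fun a b => A.coinvAux a b (A.dualCoaction ψ))
    (by
      intro a a' b
      generalize A.dualCoaction ψ = t
      induction t with
      | zero => simp
      | tmul χ x =>
        ext m
        simp [coinvAux, dualRight, dualLeft, Module.Dual.transpose_apply, add_mul]
      | add s t hs ht => rw [map_add, map_add, map_add, hs, ht]; abel)
    (by
      intro c a b
      generalize A.dualCoaction ψ = t
      induction t with
      | zero => simp
      | tmul χ x =>
        ext m
        simp [coinvAux, dualRight, dualLeft, Module.Dual.transpose_apply]
      | add s t hs ht => rw [map_add, map_add, hs, ht, smul_add])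
    (by
      intro a b b'
      generalize A.dualCoaction ψ = t
      induction t with
      | zero => simp
      | tmul χ x =>
        ext m
        simp [coinvAux, dualRight, dualLeft, Module.Dual.transpose_apply, add_mul, mul_add]
      | add s t hs ht => rw [map_add, map_add, map_add, hs, ht]; abel)
    (by
      intro c a b
      generalize A.dualCoaction ψ = t
      induction t with
      | zero => simp
      | tmul χ x =>
        ext m
        simp [coinvAux, dualRight, dualLeft, Module.Dual.transpose_apply]
      | add s t hs ht => rw [map_add, map_add, hs, ht, smul_add])) A.qR

/-- `lam` is a left cointegral on `H`: a coinvariant of the quasi-Hopf bimodule `H^*`, that is,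
an element of the image of the projection `E`. -/
def IsLeftCointegral [FiniteDimensional k H] (lam : Module.Dual k H) : Prop :=
  lam ∈ Set.range A.coinvProj

/-- The map `F_lam : H → H^*`, `F_lam(a)(b) = lam(b S(a))`. -/
def fourier (lam : Module.Dual k H) (a : H) : Module.Dual k H :=
  lam ∘ₗ LinearMap.mulRight k (A.S a)

end QuasiHopf

end

/-!
The proof regards `H^*` as a quasi-Hopf bimodule and reads off everything from the structure of its
coinvariants.

**Drinfeld's twist.**  In the rigid monoidal category of `H`-modules, `U` is the canonical
evaluation `(X ⊗ Y)^* ⊗ X → Y^*` and `V` is its counterpart for coevaluations.  A morphism of this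
kind is determined by its contraction with `α` (with `β` for `V`), and
`U (1 ⊗ α) = ∑ Δ(S(X) α) (Y ⊗ Z)`, where `φ = ∑ X ⊗ Y ⊗ Z`.  These statements become identities in
tensor powers of `H`: an element that satisfies the intertwining relation and is annihilated by
`1 ⊗ α` vanishes (`eq_zero_of_mul_α`).  With `twistFreeU`, a formula for `U` in which neither `f`
nor `f⁻¹` occurs, this gives `f * twistFreeU = (S ⊗ S)(q_R²¹)` and, by the zigzag identity
`sandwich_qS_pR`, a right inverse of `f`.  As `H ⊗ H` is finite-dimensional, `f` is invertible
(`isUnit_f`) and `U = twistFreeU` (`U_eq`).  The same uniqueness principle in `H ⊗ H ⊗ H` gives the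
compatibility of `U` and `V` with `φ` (`φinv_mul_comulSnd_twistFreeU`, `comulSnd_V_mul_φ`).

**The bimodule `H^*`.**  The identities for `U` and `V` say that the actions and the coaction make
`H^*` a quasi-Hopf bimodule (`dualBimodule`).  In every quasi-Hopf bimodule the projection `E`
satisfies `E(m₀) · m₁ = m` (`Bimodule.rightMap_proj_coact`), `E(m · a) = ε(a) E(m)`
(`Bimodule.proj_right`), and `E(n₀) ⊗ n₁ = n ⊗ 1` for `n` in the image of `E`
(`Bimodule.projCoact_proj`).

**Cointegrals.**  Let `λ ≠ 0` be in the image of `E`.  As `F_λ(a) = λ · a` in `H^*` and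
`m ↦ E(m₀) ⊗ m₁` sends `λ · a` to `λ ⊗ a`, the map `F_λ` is injective, hence bijective by
dimension.  So `x ↦ λ(x ·)` is bijective as well, and the element `r` with `λ(r ·) = ε` is the only
right integral with `λ(r) = 1`.  Such an `r` satisfies `E(χ)(r) = χ(r)`, and the coinvariants form
the line spanned by `λ`, so `E(χ) = χ(r) λ`.  Then
`ψ = E(ψ₀) · ψ₁ = λ · (ψ₀(r) ψ₁) = F_λ((id ⊗ ψ)(Δ̄(r)))`, which is the formula for the inverse of
`F_λ`; the two halves of the Frobenius basis property are the two one-sided inverse properties.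
-/

noncomputable section

-- The default depth does not reach the algebra structure of fourfold tensor powers.
set_option maxSynthPendingDepth 10

namespace QuasiHopf

/-! ### Sandwich maps -/

section Sandwich

variable {k B C D : Type*} [Field k] [Ring B] [Algebra k B] [Ring C] [Algebra k C] [Ring D]
  [Algebra k D]

/-- The linear map `c ⊗ d ↦ f(c) m g(d)`.  The contractions of tensors over a quasi-Hopf algebra
are of this form, with `f` and `g` built from the coproduct and the antipode. -/
def sandwich (f : C →ₗ[k] B) (m : B) (g : D →ₗ[k] B) : C ⊗[k] D →ₗ[k] B :=
  LinearMap.mul' k B ∘ₗ TensorProduct.map f (LinearMap.mulLeft k m ∘ₗ g)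

@[simp] theorem sandwich_tmul (f : C →ₗ[k] B) (m : B) (g : D →ₗ[k] B) (c : C) (d : D) :
    sandwich f m g (c ⊗ₜ d) = f c * (m * g d) := by
  simp [sandwich]

theorem sandwich_one {f : C →ₗ[k] B} (hf : f 1 = 1) {g : D →ₗ[k] B} (hg : g 1 = 1) (m : B) :
    sandwich f m g 1 = m := by
  rw [Algebra.TensorProduct.one_def, sandwich_tmul, hf, hg, one_mul, mul_one]

theorem sandwich_zero_mid (f : C →ₗ[k] B) (g : D →ₗ[k] B) (t : C ⊗[k] D) :
    sandwich f 0 g t = 0 := by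
  simp [sandwich]

theorem sandwich_smul_mid (f : C →ₗ[k] B) (c : k) (m : B) (g : D →ₗ[k] B) (t : C ⊗[k] D) :
    sandwich f (c • m) g t = c • sandwich f m g t := by
  induction t with
  | zero => simp
  | add t t' ht ht' => simp only [map_add, smul_add, ht, ht']
  | tmul c d => simp

theorem sandwich_add_mid (f : C →ₗ[k] B) (m m' : B) (g : D →ₗ[k] B) (t : C ⊗[k] D) :
    sandwich f (m + m') g t = sandwich f m g t + sandwich f m' g t := by
  induction t with
  | zero => simp
  | add t t' ht ht' => rw [map_add, map_add, map_add, ht, ht']; abel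
  | tmul c d => simp [add_mul, mul_add]

theorem sandwich_sub_mid (f : C →ₗ[k] B) (m m' : B) (g : D →ₗ[k] B) (t : C ⊗[k] D) :
    sandwich f (m - m') g t = sandwich f m g t - sandwich f m' g t := by
  rw [eq_sub_iff_add_eq, ← sandwich_add_mid, sub_add_cancel]

/-- Contracting a product amounts to contracting twice, innermost factor first, if the left leg is
antimultiplicative and the right leg multiplicative. -/
theorem sandwich_mul {f : C →ₗ[k] B} (hf : ∀ a b, f (a * b) = f b * f a) {g : D →ₗ[k] B}
    (hg : ∀ a b, g (a * b) = g a * g b) (m : B) (s t : C ⊗[k] D) :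
    sandwich f m g (s * t) = sandwich f (sandwich f m g s) g t := by
  induction t with
  | zero => simp
  | add t t' ht ht' => rw [mul_add, map_add, map_add, ht, ht']
  | tmul c d =>
    induction s with
    | zero => simp
    | add s s' hs hs' =>
      rw [add_mul, map_add, map_add, hs, hs']; simp only [sandwich_tmul, mul_add, add_mul]
    | tmul c' d' => simp [hf, hg, mul_assoc]

/-- The version of `sandwich_mul` with a multiplicative left and an antimultiplicative right leg. -/
theorem sandwich_mul' {f : C →ₗ[k] B} (hf : ∀ a b, f (a * b) = f a * f b) {g : D →ₗ[k] B}
    (hg : ∀ a b, g (a * b) = g b * g a) (m : B) (s t : C ⊗[k] D) :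
    sandwich f m g (s * t) = sandwich f (sandwich f m g t) g s := by
  induction t with
  | zero => simp [sandwich]
  | add t t' ht ht' =>
    rw [mul_add, map_add, map_add, ht, ht']
    clear ht ht'
    induction s with
    | zero => simp
    | add s s' hs hs' => rw [map_add, map_add, map_add, ← hs, ← hs']; abel
    | tmul c d => simp only [sandwich_tmul, mul_add, add_mul]
  | tmul c d =>
    induction s with
    | zero => simp
    | add s s' hs hs' => rw [add_mul, map_add, map_add, hs, hs']
    | tmul c' d' => simp [hf, hg, mul_assoc]

end Sandwich

section Induction

variable {k H : Type*} [Field k] [Ring H] [Algebra k H]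

@[elab_as_elim]
theorem tensor₃_induction {p : H ⊗[k] (H ⊗[k] H) → Prop} (t : H ⊗[k] (H ⊗[k] H))
    (tmul : ∀ a b c : H, p (a ⊗ₜ (b ⊗ₜ c))) (add : ∀ s t, p s → p t → p (s + t)) : p t := by
  induction t with
  | zero => simpa using tmul 0 0 0
  | add s t hs ht => exact add s t hs ht
  | tmul a u =>
    induction u with
    | zero => simpa using tmul 0 0 0
    | add s t hs ht => rw [TensorProduct.tmul_add]; exact add _ _ hs ht
    | tmul b c => exact tmul a b c

@[elab_as_elim]
theorem tensor₄_induction {p : H ⊗[k] (H ⊗[k] (H ⊗[k] H)) → Prop}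
    (t : H ⊗[k] (H ⊗[k] (H ⊗[k] H)))
    (tmul : ∀ a b c d : H, p (a ⊗ₜ (b ⊗ₜ (c ⊗ₜ d)))) (add : ∀ s t, p s → p t → p (s + t)) :
    p t := by
  induction t with
  | zero => simpa using tmul 0 0 0 0
  | add s t hs ht => exact add s t hs ht
  | tmul a u =>
    induction u using tensor₃_induction with
    | add s t hs ht => rw [TensorProduct.tmul_add]; exact add _ _ hs ht
    | tmul b c d => exact tmul a b c d

end Induction

variable {k H : Type*} [Field k] [Ring H] [Algebra k H] (A : QuasiHopf k H)

/-! ### The antipode and its inverse -/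

theorem S_mul (a b : H) : A.S (a * b) = A.S b * A.S a := A.antipode_mul a b
@[simp] theorem S_one : A.S 1 = 1 := A.antipode_one
@[simp] theorem Sinv_S (a : H) : A.Sinv (A.S a) = a := A.antipode.symm_apply_apply a
@[simp] theorem S_Sinv (a : H) : A.S (A.Sinv a) = a := A.antipode.apply_symm_apply a
theorem S_injective : Function.Injective A.S := A.antipode.injective
theorem Sinv_mul (a b : H) : A.Sinv (a * b) = A.Sinv b * A.Sinv a :=
  A.S_injective (by simp [S_mul])
@[simp] theorem Sinv_one : A.Sinv 1 = 1 := A.S_injective (by simp)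

@[simp] theorem SSflip_tmul (a b : H) : A.SSflip (a ⊗ₜ b) = A.S b ⊗ₜ A.S a := by simp [SSflip]
@[simp] theorem SinvSinvFlip_tmul (a b : H) :
    A.SinvSinvFlip (a ⊗ₜ b) = A.Sinv b ⊗ₜ A.Sinv a := by simp [SinvSinvFlip]

theorem SSflip_mul (s t : H ⊗[k] H) : A.SSflip (s * t) = A.SSflip t * A.SSflip s := by
  induction t with
  | zero => simp
  | add t t' ht ht' => simp only [mul_add, map_add, add_mul, ht, ht']
  | tmul a b =>
    induction s with
    | zero => simp
    | add s s' hs hs' => simp only [mul_add, map_add, add_mul, hs, hs']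
    | tmul c d => simp [S_mul]

theorem SinvSinvFlip_mul (s t : H ⊗[k] H) :
    A.SinvSinvFlip (s * t) = A.SinvSinvFlip t * A.SinvSinvFlip s := by
  induction t with
  | zero => simp
  | add t t' ht ht' => simp only [mul_add, map_add, add_mul, ht, ht']
  | tmul a b =>
    induction s with
    | zero => simp
    | add s s' hs hs' => simp only [mul_add, map_add, add_mul, hs, hs']
    | tmul c d => simp [Sinv_mul]

@[simp] theorem SinvSinvFlip_SSflip (t : H ⊗[k] H) : A.SinvSinvFlip (A.SSflip t) = t := by
  induction t with
  | zero => simp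
  | add t t' ht ht' => simp only [map_add, ht, ht']
  | tmul a b => simp

/-! ### Contractions with `α` and `β` -/

/-- `a ⊗ b ↦ S(a) α b`. -/
def evalα : H ⊗[k] H →ₗ[k] H := sandwich A.S A.α LinearMap.id

@[simp] theorem evalα_tmul (a b : H) : A.evalα (a ⊗ₜ b) = A.S a * (A.α * b) := by simp [evalα]
@[simp] theorem contractβ_tmul (a b : H) : A.contractβ (a ⊗ₜ b) = a * (A.β * A.S b) := by
  simp [contractβ]
@[simp] theorem contractα_tmul (a b : H) : A.contractα (a ⊗ₜ b) = A.Sinv (A.α * b) * a := by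
  simp [contractα]

theorem S_contractα (t : H ⊗[k] H) : A.S (A.contractα t) = A.evalα t := by
  induction t with
  | zero => simp
  | add s t hs ht => simp only [map_add, hs, ht]
  | tmul a b => simp [S_mul]

theorem evalα_comul (a : H) : A.evalα (A.comul a) = A.counit a • A.α := A.antipode_α a
theorem contractβ_comul (a : H) : A.contractβ (A.comul a) = A.counit a • A.β := A.β_antipode a

theorem evalα_comul_mul (a : H) (t : H ⊗[k] H) :
    A.evalα (A.comul a * t) = A.counit a • A.evalα t := by
  rw [evalα, sandwich_mul A.S_mul (fun _ _ => rfl)]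
  have := A.evalα_comul a
  rw [evalα] at this
  rw [this]
  induction t with
  | zero => simp
  | add s t hs ht => simp only [map_add, smul_add, hs, ht]
  | tmul a b => simp

theorem contractβ_mul_comul (a : H) (t : H ⊗[k] H) :
    A.contractβ (t * A.comul a) = A.counit a • A.contractβ t := by
  have h : A.contractβ = sandwich LinearMap.id A.β A.S := rfl
  have := A.contractβ_comul a
  rw [h] at this
  rw [h, sandwich_mul' (fun _ _ => rfl) A.S_mul, this]
  induction t with
  | zero => simp
  | add s t hs ht => simp only [map_add, smul_add, hs, ht]
  | tmul a b => simp

/-- `a ⊗ b ⊗ c ↦ a β S(b) α c`. -/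
def zigzag : H ⊗[k] (H ⊗[k] H) →ₗ[k] H := sandwich LinearMap.id A.β A.evalα

/-- `a ⊗ b ⊗ c ↦ S(a) α b β S(c)`. -/
def zigzagInv : H ⊗[k] (H ⊗[k] H) →ₗ[k] H := sandwich A.S A.α A.contractβ

@[simp] theorem zigzag_tmul (a : H) (t : H ⊗[k] H) :
    A.zigzag (a ⊗ₜ t) = a * (A.β * A.evalα t) := by simp [zigzag]
@[simp] theorem zigzagInv_tmul (a : H) (t : H ⊗[k] H) :
    A.zigzagInv (a ⊗ₜ t) = A.S a * (A.α * A.contractβ t) := by simp [zigzagInv]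
theorem zigzag_φ : A.zigzag A.φ = 1 := A.reassoc_antipode
theorem zigzagInv_φinv : A.zigzagInv A.φinv = 1 := A.reassoc_inv_antipode

/-! ### Coproducts on tensor powers -/

/-- `Δ ⊗ id` on `H ⊗ H`. -/
def comulFst : H ⊗[k] H →ₐ[k] H ⊗[k] (H ⊗[k] H) :=
  (Algebra.TensorProduct.assoc k k k H H H).toAlgHom.comp
    (Algebra.TensorProduct.map A.comul (AlgHom.id k H))

/-- `id ⊗ Δ` on `H ⊗ H`. -/
def comulSnd : H ⊗[k] H →ₐ[k] H ⊗[k] (H ⊗[k] H) :=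
  Algebra.TensorProduct.map (AlgHom.id k H) A.comul

/-- `Δ ⊗ id ⊗ id` on `H ⊗ H ⊗ H`. -/
def comul₁ : H ⊗[k] (H ⊗[k] H) →ₐ[k] H ⊗[k] (H ⊗[k] (H ⊗[k] H)) :=
  (Algebra.TensorProduct.assoc k k k H H (H ⊗[k] H)).toAlgHom.comp
    (Algebra.TensorProduct.map A.comul (AlgHom.id k (H ⊗[k] H)))

/-- `id ⊗ Δ ⊗ id` on `H ⊗ H ⊗ H`. -/
def comul₂ : H ⊗[k] (H ⊗[k] H) →ₐ[k] H ⊗[k] (H ⊗[k] (H ⊗[k] H)) :=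
  Algebra.TensorProduct.map (AlgHom.id k H) A.comulFst

/-- `id ⊗ id ⊗ Δ` on `H ⊗ H ⊗ H`. -/
def comul₃ : H ⊗[k] (H ⊗[k] H) →ₐ[k] H ⊗[k] (H ⊗[k] (H ⊗[k] H)) :=
  Algebra.TensorProduct.map (AlgHom.id k H) A.comulSnd

variable (k H) in
/-- `t ↦ t ⊗ 1` on `H ⊗ H`. -/
def appendOne : H ⊗[k] H →ₐ[k] H ⊗[k] (H ⊗[k] H) :=
  (Algebra.TensorProduct.assoc k k k H H H).toAlgHom.comp
    Algebra.TensorProduct.includeLeft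

variable (k H) in
/-- `t ↦ t ⊗ 1` on `H ⊗ H ⊗ H`. -/
def appendOne₃ : H ⊗[k] (H ⊗[k] H) →ₐ[k] H ⊗[k] (H ⊗[k] (H ⊗[k] H)) :=
  Algebra.TensorProduct.map (AlgHom.id k H) (appendOne k H)

variable (k H) in
/-- The element `a ⊗ b ⊗ c` of `H ⊗ H ⊗ H`, for `s = a ⊗ b` and `c`. -/
def join (s : H ⊗[k] H) (c : H) : H ⊗[k] (H ⊗[k] H) :=
  Algebra.TensorProduct.assoc k k k H H H (s ⊗ₜ c)

variable (k H) in
/-- The element `a ⊗ b ⊗ c ⊗ d` of `H ⊗ H ⊗ H ⊗ H`, for `s = a ⊗ b` and `t = c ⊗ d`. -/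
def join₂ (s t : H ⊗[k] H) : H ⊗[k] (H ⊗[k] (H ⊗[k] H)) :=
  Algebra.TensorProduct.assoc k k k H H (H ⊗[k] H) (s ⊗ₜ t)

@[simp] theorem join_tmul (a b c : H) : join k H (a ⊗ₜ b) c = a ⊗ₜ (b ⊗ₜ c) := by simp [join]
@[simp] theorem join₂_tmul (a b : H) (t : H ⊗[k] H) :
    join₂ k H (a ⊗ₜ b) t = a ⊗ₜ (b ⊗ₜ t) := by simp [join₂]
@[simp] theorem join_one (c : H) : join k H 1 c = 1 ⊗ₜ (1 ⊗ₜ c) := by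
  rw [Algebra.TensorProduct.one_def, join_tmul]
@[simp] theorem join_zero (c : H) : join k H 0 c = 0 := by simp [join]
@[simp] theorem join₂_zero (t : H ⊗[k] H) : join₂ k H 0 t = 0 := by simp [join₂]
theorem join_add (s s' : H ⊗[k] H) (c : H) :
    join k H (s + s') c = join k H s c + join k H s' c := by simp [join, TensorProduct.add_tmul]
theorem join₂_add (s s' t : H ⊗[k] H) :
    join₂ k H (s + s') t = join₂ k H s t + join₂ k H s' t := by
  simp [join₂, TensorProduct.add_tmul]
theorem join_mul (s s' : H ⊗[k] H) (c c' : H) :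
    join k H s c * join k H s' c' = join k H (s * s') (c * c') := by
  rw [join, join, join, ← map_mul, Algebra.TensorProduct.tmul_mul_tmul]
@[simp] theorem comulFst_tmul (a b : H) : A.comulFst (a ⊗ₜ b) = join k H (A.comul a) b := rfl
@[simp] theorem comulSnd_tmul (a b : H) : A.comulSnd (a ⊗ₜ b) = a ⊗ₜ A.comul b := rfl
@[simp] theorem comul₁_tmul (a : H) (t : H ⊗[k] H) :
    A.comul₁ (a ⊗ₜ t) = join₂ k H (A.comul a) t := rfl
@[simp] theorem comul₂_tmul (a : H) (t : H ⊗[k] H) :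
    A.comul₂ (a ⊗ₜ t) = a ⊗ₜ A.comulFst t := rfl
@[simp] theorem comul₃_tmul (a : H) (t : H ⊗[k] H) :
    A.comul₃ (a ⊗ₜ t) = a ⊗ₜ A.comulSnd t := rfl
@[simp] theorem appendOne_tmul (a b : H) :
    appendOne k H (a ⊗ₜ b) = a ⊗ₜ (b ⊗ₜ (1 : H)) := rfl
theorem appendOne_eq_join (t : H ⊗[k] H) : appendOne k H t = join k H t 1 := rfl
@[simp] theorem appendOne₃_tmul (a : H) (t : H ⊗[k] H) :
    appendOne₃ k H (a ⊗ₜ t) = a ⊗ₜ appendOne k H t := rfl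

/-! ### The reassociator -/

@[simp] theorem φ_mul_φinv : A.φ * A.φinv = 1 := A.reassoc.mul_inv
@[simp] theorem φinv_mul_φ : A.φinv * A.φ = 1 := A.reassoc.inv_mul

theorem comulSnd_comul_mul_φ (a : H) :
    A.comulSnd (A.comul a) * A.φ = A.φ * A.comulFst (A.comul a) := A.quasi_coassoc a

theorem φinv_mul_comulSnd_comul (a : H) :
    A.φinv * A.comulSnd (A.comul a) = A.comulFst (A.comul a) * A.φinv := by
  calc A.φinv * A.comulSnd (A.comul a)
      = A.φinv * (A.comulSnd (A.comul a) * A.φ) * A.φinv := by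
        rw [mul_assoc, mul_assoc, φ_mul_φinv, mul_one]
    _ = _ := by rw [comulSnd_comul_mul_φ, ← mul_assoc, φinv_mul_φ, one_mul]

theorem pentagon_eq : A.comul₃ A.φ * A.comul₁ A.φ =
    ((1 : H) ⊗ₜ[k] A.φ) * A.comul₂ A.φ * appendOne₃ k H A.φ := by
  have h := A.pentagon
  have h2 : ∀ t : H ⊗[k] (H ⊗[k] H), Algebra.TensorProduct.map (AlgHom.id k H)
        (Algebra.TensorProduct.assoc k k k H H H).toAlgHom
        (Algebra.TensorProduct.assoc k k k H (H ⊗[k] H) H (t ⊗ₜ[k] (1 : H)))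
      = appendOne₃ k H t := by
    intro t
    induction t with
    | zero => simp
    | add s t hs ht => rw [TensorProduct.add_tmul, map_add, map_add, map_add, hs, ht]
    | tmul a u => rfl
  rw [h2] at h
  exact h

/-- The reassociators of the pentagon as units of `H ⊗ H ⊗ H ⊗ H`. -/
theorem exists_pentagon_units : ∃ a b c d e : (H ⊗[k] (H ⊗[k] (H ⊗[k] H)))ˣ,
    (a : H ⊗[k] (H ⊗[k] (H ⊗[k] H))) = A.comul₃ A.φ ∧ (↑a⁻¹ = A.comul₃ A.φinv) ∧
    (b : H ⊗[k] (H ⊗[k] (H ⊗[k] H))) = A.comul₁ A.φ ∧ (↑b⁻¹ = A.comul₁ A.φinv) ∧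
    (c : H ⊗[k] (H ⊗[k] (H ⊗[k] H))) = (1 : H) ⊗ₜ A.φ ∧ (↑c⁻¹ = (1 : H) ⊗ₜ[k] A.φinv) ∧
    (d : H ⊗[k] (H ⊗[k] (H ⊗[k] H))) = A.comul₂ A.φ ∧ (↑d⁻¹ = A.comul₂ A.φinv) ∧
    (e : H ⊗[k] (H ⊗[k] (H ⊗[k] H))) = appendOne₃ k H A.φ ∧
      (↑e⁻¹ = appendOne₃ k H A.φinv) ∧ a * b = c * d * e := by
  refine ⟨Units.map (A.comul₃ : _ →* _) A.reassoc, Units.map (A.comul₁ : _ →* _) A.reassoc,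
    Units.map ((Algebra.TensorProduct.includeRight :
      H ⊗[k] (H ⊗[k] H) →ₐ[k] H ⊗[k] (H ⊗[k] (H ⊗[k] H))) : _ →* _) A.reassoc,
    Units.map (A.comul₂ : _ →* _) A.reassoc, Units.map (appendOne₃ k H : _ →* _) A.reassoc,
    rfl, rfl, rfl, rfl, rfl, rfl, rfl, rfl, rfl, rfl, Units.ext ?_⟩
  exact A.pentagon_eq

theorem one_tmul_φinv_mul : ((1 : H) ⊗ₜ[k] A.φinv) * (A.comul₃ A.φ * A.comul₁ A.φ) =
    A.comul₂ A.φ * appendOne₃ k H A.φ := by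
  obtain ⟨a, b, c, d, e, ha, ha', hb, hb', hc, hc', hd, hd', he, he', h⟩ := A.exists_pentagon_units
  rw [← ha, ← hb, ← hc', ← hd, ← he]
  have : c⁻¹ * (a * b) = d * e := by rw [h]; group
  exact congrArg Units.val this

theorem appendOne₃_mul_comul₁_φinv : appendOne₃ k H A.φ * A.comul₁ A.φinv =
    A.comul₂ A.φinv * (((1 : H) ⊗ₜ[k] A.φinv) * A.comul₃ A.φ) := by
  obtain ⟨a, b, c, d, e, ha, ha', hb, hb', hc, hc', hd, hd', he, he', h⟩ := A.exists_pentagon_units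
  rw [← he, ← hb', ← hd', ← hc', ← ha]
  have : e * b⁻¹ = d⁻¹ * (c⁻¹ * a) := by rw [eq_mul_inv_of_mul_eq h]; group
  exact congrArg Units.val this

theorem comul₁_mul_appendOne₃_φinv : A.comul₁ A.φ * appendOne₃ k H A.φinv =
    A.comul₃ A.φinv * (((1 : H) ⊗ₜ[k] A.φ) * A.comul₂ A.φ) := by
  obtain ⟨a, b, c, d, e, ha, ha', hb, hb', hc, hc', hd, hd', he, he', h⟩ := A.exists_pentagon_units
  rw [← hb, ← he', ← ha', ← hc, ← hd]
  have : b * e⁻¹ = a⁻¹ * (c * d) := by rw [eq_inv_mul_of_mul_eq h]; group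
  exact congrArg Units.val this

theorem one_tmul_φinv_mul_comul₃ : ((1 : H) ⊗ₜ[k] A.φinv) * A.comul₃ A.φ =
    A.comul₂ A.φ * (appendOne₃ k H A.φ * A.comul₁ A.φinv) := by
  obtain ⟨a, b, c, d, e, ha, ha', hb, hb', hc, hc', hd, hd', he, he', h⟩ := A.exists_pentagon_units
  rw [← hc', ← ha, ← hd, ← he, ← hb']
  have : c⁻¹ * a = d * (e * b⁻¹) := by rw [eq_mul_inv_of_mul_eq h]; group
  exact congrArg Units.val this

theorem comul₁_mul_comul₃_φinv_mul : A.comul₁ A.φinv * (A.comul₃ A.φinv * ((1 : H) ⊗ₜ[k] A.φ)) =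
    appendOne₃ k H A.φinv * A.comul₂ A.φinv := by
  obtain ⟨a, b, c, d, e, ha, ha', hb, hb', hc, hc', hd, hd', he, he', h⟩ := A.exists_pentagon_units
  rw [← hb', ← ha', ← hc, ← he', ← hd']
  have : b⁻¹ * (a⁻¹ * c) = e⁻¹ * d⁻¹ := by rw [eq_mul_inv_of_mul_eq h]; group
  exact congrArg Units.val this

/-! ### The counit -/

/-- `ε ⊗ id ⊗ id` on `H ⊗ H ⊗ H`. -/
def counit₁ : H ⊗[k] (H ⊗[k] H) →ₐ[k] H ⊗[k] H :=
  (Algebra.TensorProduct.lid k (H ⊗[k] H)).toAlgHom.comp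
    (Algebra.TensorProduct.map A.counit (AlgHom.id k (H ⊗[k] H)))

/-- `ε ⊗ id` on `H ⊗ H`. -/
def counitFst : H ⊗[k] H →ₐ[k] H :=
  (Algebra.TensorProduct.lid k H).toAlgHom.comp
    (Algebra.TensorProduct.map A.counit (AlgHom.id k H))

/-- `id ⊗ ε` on `H ⊗ H`. -/
def counitSnd : H ⊗[k] H →ₐ[k] H :=
  (Algebra.TensorProduct.rid k k H).toAlgHom.comp
    (Algebra.TensorProduct.map (AlgHom.id k H) A.counit)

/-- `id ⊗ ε ⊗ id` on `H ⊗ H ⊗ H`. -/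
def counit₂ : H ⊗[k] (H ⊗[k] H) →ₐ[k] H ⊗[k] H :=
  Algebra.TensorProduct.map (AlgHom.id k H) A.counitFst

/-- `id ⊗ id ⊗ ε` on `H ⊗ H ⊗ H`. -/
def counit₃ : H ⊗[k] (H ⊗[k] H) →ₐ[k] H ⊗[k] H :=
  Algebra.TensorProduct.map (AlgHom.id k H) A.counitSnd

@[simp] theorem counitFst_tmul (a b : H) : A.counitFst (a ⊗ₜ b) = A.counit a • b := by
  simp [counitFst]
@[simp] theorem counitSnd_tmul (a b : H) : A.counitSnd (a ⊗ₜ b) = A.counit b • a := by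
  simp [counitSnd]
@[simp] theorem counit₁_tmul (a : H) (t : H ⊗[k] H) :
    A.counit₁ (a ⊗ₜ t) = A.counit a • t := by simp [counit₁]
@[simp] theorem counit₂_tmul (a : H) (t : H ⊗[k] H) :
    A.counit₂ (a ⊗ₜ t) = a ⊗ₜ A.counitFst t := by simp [counit₂]
@[simp] theorem counit₃_tmul (a : H) (t : H ⊗[k] H) :
    A.counit₃ (a ⊗ₜ t) = a ⊗ₜ A.counitSnd t := by simp [counit₃]

@[simp] theorem counitFst_comul (a : H) : A.counitFst (A.comul a) = a := A.counit_comul a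
@[simp] theorem counitSnd_comul (a : H) : A.counitSnd (A.comul a) = a := A.comul_counit a

theorem counit₂_φ : A.counit₂ A.φ = 1 := A.counit_reassoc

theorem map_φinv_eq_one {B : Type*} [Ring B] [Algebra k B] (g : H ⊗[k] (H ⊗[k] H) →ₐ[k] B)
    (h : g A.φ = 1) : g A.φinv = 1 := by
  have := congrArg g A.φ_mul_φinv
  rwa [map_mul, h, one_mul, map_one] at this

theorem counit₂_φinv : A.counit₂ A.φinv = 1 := A.map_φinv_eq_one _ A.counit₂_φ

theorem counit₁_φ : A.counit₁ A.φ = 1 := by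
  -- Apply `ε` to the second factor of the pentagon identity.
  let E : H ⊗[k] (H ⊗[k] (H ⊗[k] H)) →ₐ[k] H ⊗[k] (H ⊗[k] H) :=
    Algebra.TensorProduct.map (AlgHom.id k H) A.counit₁
  have E3 : ∀ t, E (A.comul₃ t) = A.comulSnd (A.counit₂ t) := by
    intro t
    induction t using tensor₃_induction with
    | add s t hs ht => simp only [map_add, hs, ht]
    | tmul a b c => simp [E]
  have E1 : ∀ t, E (A.comul₁ t) = t := by
    intro t
    induction t with
    | zero => simp
    | add s t hs ht => simp only [map_add, hs, ht]
    | tmul a u =>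
      have : ∀ s, E (join₂ k H s u) = A.counitSnd s ⊗ₜ u := by
        intro s
        induction s with
        | zero => simp
        | add s t hs ht => simp only [map_add, join₂_add, TensorProduct.add_tmul, hs, ht]
        | tmul a b => simp [E, TensorProduct.smul_tmul]
      simp [this]
  have E2 : ∀ t, E (A.comul₂ t) = t := by
    intro t
    induction t using tensor₃_induction with
    | add s t hs ht => simp only [map_add, hs, ht]
    | tmul a b c =>
      have : ∀ s, A.counit₁ (join k H s c) = A.counitFst s ⊗ₜ c := by
        intro s
        induction s with
        | zero => simp
        | add s t hs ht => simp only [map_add, join_add, TensorProduct.add_tmul, hs, ht]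
        | tmul a b => simp [TensorProduct.smul_tmul']
      simp [this, E]
  have Ee : ∀ t, E (appendOne₃ k H t) = appendOne k H (A.counit₂ t) := by
    intro t
    induction t using tensor₃_induction with
    | add s t hs ht => simp only [map_add, hs, ht]
    | tmul a b c => simp [E]
  have h := congrArg E A.pentagon_eq
  rw [map_mul, map_mul, map_mul, E3, E1, E2, Ee, counit₂_φ, map_one, map_one, one_mul, mul_one] at h
  have h2 : (1 : H) ⊗ₜ[k] A.counit₁ A.φ = 1 := by
    have h3 := congrArg (· * A.φinv) h
    simp only [mul_assoc, φ_mul_φinv, mul_one] at h3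
    simpa [E] using h3.symm
  have h4 := congrArg A.counit₁ h2
  simpa using h4

theorem counit₃_φ : A.counit₃ A.φ = 1 := by
  -- Apply `ε` to the third factor of the pentagon identity.
  let E : H ⊗[k] (H ⊗[k] (H ⊗[k] H)) →ₐ[k] H ⊗[k] (H ⊗[k] H) :=
    Algebra.TensorProduct.map (AlgHom.id k H) A.counit₂
  have E3 : ∀ t, E (A.comul₃ t) = t := by
    intro t
    induction t using tensor₃_induction with
    | add s t hs ht => simp only [map_add, hs, ht]
    | tmul a b c => simp [E]
  have E1 : ∀ t, E (A.comul₁ t) = A.comulFst (A.counit₂ t) := by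
    intro t
    induction t using tensor₃_induction with
    | add s t hs ht => simp only [map_add, hs, ht]
    | tmul a b c =>
      have : ∀ s, E (join₂ k H s (b ⊗ₜ c)) = join k H s (A.counit b • c) := by
        intro s
        induction s with
        | zero => simp
        | add s t hs ht => simp only [map_add, join_add, join₂_add, hs, ht]
        | tmul a b => simp [E]
      simp [this]
      simp [join]
  have E2 : ∀ t, E (A.comul₂ t) = t := by
    intro t
    induction t using tensor₃_induction with
    | add s t hs ht => simp only [map_add, hs, ht]
    | tmul a b c =>
      have : ∀ s, A.counit₂ (join k H s c) = A.counitSnd s ⊗ₜ c := by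
        intro s
        induction s with
        | zero => simp
        | add s t hs ht => simp only [map_add, join_add, TensorProduct.add_tmul, hs, ht]
        | tmul a b => simp [TensorProduct.smul_tmul]
      simp [this, E]
  have Ee : ∀ t, E (appendOne₃ k H t) = appendOne k H (A.counit₃ t) := by
    intro t
    induction t using tensor₃_induction with
    | add s t hs ht => simp only [map_add, hs, ht]
    | tmul a b c => simp [E]
  have h := congrArg E A.pentagon_eq
  rw [map_mul, map_mul, map_mul, E3, E1, E2, Ee, counit₂_φ, map_one, mul_one] at h
  have h0 : E ((1 : H) ⊗ₜ A.φ) = 1 := by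
    simp [E, counit₂_φ, Algebra.TensorProduct.one_def]
  have h2 : appendOne k H (A.counit₃ A.φ) = 1 := by
    have h3 := congrArg (A.φinv * ·) h
    simpa [h0, ← mul_assoc] using h3.symm
  have h4 := congrArg A.counit₃ h2
  have h5 : ∀ t, A.counit₃ (appendOne k H t) = t := by
    intro t
    induction t with
    | zero => simp
    | add s t hs ht => simp only [map_add, hs, ht]
    | tmul a b => simp
  rwa [h5, map_one] at h4

theorem counit₁_φinv : A.counit₁ A.φinv = 1 := A.map_φinv_eq_one _ A.counit₁_φ
theorem counit₃_φinv : A.counit₃ A.φinv = 1 := A.map_φinv_eq_one _ A.counit₃_φ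

theorem counit_S_mul_counit_α (a : H) :
    A.counit (A.S a) * A.counit A.α = A.counit a * A.counit A.α := by
  have h : ∀ t : H ⊗[k] H, A.counit (A.evalα t) =
      A.counit (A.S (A.counitSnd t)) * A.counit A.α := by
    intro t
    induction t with
    | zero => simp
    | add s t hs ht => simp only [map_add, add_mul, hs, ht]
    | tmul a b => simp; ring
  have := h (A.comul a)
  rw [evalα_comul, counitSnd_comul] at this
  simpa using this.symm

theorem counit_α_mul_counit_β : A.counit A.α * A.counit A.β = 1 := by
  have h : ∀ t : H ⊗[k] (H ⊗[k] H), A.counit (A.zigzag t) =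
      A.counit A.α * A.counit A.β * A.counit (A.counitFst (A.counit₂ t)) := by
    intro t
    induction t using tensor₃_induction with
    | add s t hs ht => simp only [map_add, mul_add, hs, ht]
    | tmul a b c =>
      have := A.counit_S_mul_counit_α b
      simp
      linear_combination (A.counit a * A.counit A.β * A.counit c) * this
  have := h A.φ
  rw [zigzag_φ, counit₂_φ] at this
  simpa using this.symm

@[simp] theorem counit_S (a : H) : A.counit (A.S a) = A.counit a :=
  mul_right_cancel₀ (left_ne_zero_of_mul_eq_one A.counit_α_mul_counit_β)
    (A.counit_S_mul_counit_α a)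

@[simp] theorem counit_Sinv (a : H) : A.counit (A.Sinv a) = A.counit a := by
  rw [← counit_S, S_Sinv]

/-! ### The elements `p_R` and `q_R` -/

variable (k H) in
/-- `a ↦ a ⊗ 1`. -/
abbrev inl : H →ₐ[k] H ⊗[k] H := Algebra.TensorProduct.includeLeft

variable (k H) in
/-- `b ↦ 1 ⊗ b`. -/
abbrev inr : H →ₐ[k] H ⊗[k] H := Algebra.TensorProduct.includeRight

/-- `b ↦ 1 ⊗ S(b)`. -/
def inrS : H →ₗ[k] H ⊗[k] H := (inr k H).toLinearMap ∘ₗ A.S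

/-- The antimultiplicative map `(S ⊗ S) Δᵒᵖ`. -/
def comulS : H →ₗ[k] H ⊗[k] H := A.SSflip ∘ₗ A.comul.toLinearMap

@[simp] theorem inrS_apply (b : H) : A.inrS b = (1 : H) ⊗ₜ A.S b := rfl
theorem comulS_apply (a : H) : A.comulS a = A.SSflip (A.comul a) := rfl
@[simp] theorem comulS_one : A.comulS 1 = 1 := by
  simp [comulS_apply, Algebra.TensorProduct.one_def]
theorem inrS_mul (a b : H) : A.inrS (a * b) = A.inrS b * A.inrS a := by simp [S_mul]
theorem comulS_mul (a b : H) : A.comulS (a * b) = A.comulS b * A.comulS a := by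
  simp [comulS_apply, SSflip_mul]

theorem map_contractβ_mul_comulSnd (t : H ⊗[k] H) (u : H ⊗[k] (H ⊗[k] H)) :
    TensorProduct.map LinearMap.id A.contractβ (u * A.comulSnd t) =
      TensorProduct.map LinearMap.id A.contractβ u * (A.counitSnd t ⊗ₜ 1) := by
  induction t with
  | zero => simp
  | add s t hs ht => simp only [map_add, mul_add, TensorProduct.add_tmul, hs, ht]
  | tmul a b =>
    induction u with
    | zero => simp
    | add s t hs ht => simp only [map_add, add_mul, hs, ht]
    | tmul c d => simp [contractβ_mul_comul, TensorProduct.smul_tmul']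

theorem map_contractβ_comulFst_mul (t : H ⊗[k] H) (u : H ⊗[k] (H ⊗[k] H)) :
    TensorProduct.map LinearMap.id A.contractβ (A.comulFst t * u) =
      sandwich A.comul.toLinearMap (TensorProduct.map LinearMap.id A.contractβ u) A.inrS t := by
  induction t with
  | zero => simp
  | add s t hs ht => simp only [map_add, add_mul, hs, ht]
  | tmul a b =>
    simp only [comulFst_tmul, sandwich_tmul, AlgHom.toLinearMap_apply]
    generalize A.comul a = s
    induction s with
    | zero => simp
    | add s t hs ht => simp only [map_add, add_mul, join_add, hs, ht]
    | tmul c d =>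
      induction u using tensor₃_induction with
      | add s t hs ht => simp only [map_add, mul_add, add_mul, hs, ht]
      | tmul x y z => simp [S_mul, mul_assoc]

/-- `p_R (a ⊗ 1) = ∑ Δ(a₁) p_R (1 ⊗ S(a₂))`. -/
theorem pR_mul (a : H) : A.pR * (a ⊗ₜ[k] (1 : H)) =
    sandwich A.comul.toLinearMap A.pR A.inrS (A.comul a) := by
  have h := A.map_contractβ_mul_comulSnd (A.comul a) A.φinv
  rw [counitSnd_comul] at h
  rw [pR, ← h, φinv_mul_comulSnd_comul, map_contractβ_comulFst_mul]

/-- `∑ Δ(X) p_R (1 ⊗ S(Y) α Z) = 1 ⊗ 1`, where `φ = ∑ X ⊗ Y ⊗ Z`. -/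
theorem sandwich_pR_φ :
    sandwich A.comul.toLinearMap A.pR ((inr k H).toLinearMap ∘ₗ A.evalα) A.φ = 1 := by
  -- The left side is a contraction `c` of a fourfold tensor; after the pentagon identity, the
  -- coproducts in the last two and in the middle two factors are absorbed by `α` and `β`.
  let c : H ⊗[k] (H ⊗[k] (H ⊗[k] H)) →ₗ[k] H ⊗[k] H := TensorProduct.map LinearMap.id A.zigzag
  have h1 : ∀ s t, sandwich A.comul.toLinearMap (TensorProduct.map LinearMap.id A.contractβ t)
      ((inr k H).toLinearMap ∘ₗ A.evalα) s = c (A.comul₁ s * appendOne₃ k H t) := by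
    intro s t
    induction s using tensor₃_induction with
    | add s s' hs hs' => simp only [map_add, add_mul, hs, hs']
    | tmul X Y Z =>
      simp only [sandwich_tmul, comul₁_tmul, AlgHom.toLinearMap_apply]
      generalize A.comul X = w
      induction w with
      | zero => simp
      | add s t hs ht => simp only [map_add, add_mul, join₂_add, hs, ht]
      | tmul a b =>
        induction t using tensor₃_induction with
        | add s t hs ht => simp only [map_add, mul_add, add_mul, hs, ht]
        | tmul x y z => simp [S_mul, mul_assoc, c]
  have h2 : ∀ s t, c (A.comul₃ s * t) = A.counit₃ s * c t := by
    intro s t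
    induction s using tensor₃_induction with
    | add s s' hs hs' => simp only [map_add, add_mul, hs, hs']
    | tmul x y z =>
      induction t with
      | zero => simp
      | add s t hs ht => simp only [map_add, mul_add, hs, ht]
      | tmul a u =>
        induction u with
        | zero => simp
        | add s t hs ht => simp only [map_add, mul_add, TensorProduct.tmul_add, hs, ht]
        | tmul b v => simp [c, evalα_comul_mul, mul_assoc]
  have h3 : ∀ s t, c (((1 : H) ⊗ₜ[k] s) * A.comul₂ t) =
      ((1 : H) ⊗ₜ[k] A.zigzag s) * A.counit₂ t := by
    intro s t
    induction t using tensor₃_induction with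
    | add t t' ht ht' => simp only [map_add, mul_add, ht, ht']
    | tmul a b d =>
      have : ∀ v, A.zigzag (s * join k H v d) =
          sandwich LinearMap.id (A.contractβ v) A.evalα s * d := by
        intro v
        induction s using tensor₃_induction with
        | add s s' hs hs' => simp only [map_add, add_mul, hs, hs']
        | tmul x y z =>
          induction v with
          | zero => simp [sandwich]
          | add s t hs ht =>
            simp only [join_add, map_add, mul_add, hs, ht, sandwich_tmul, add_mul]
          | tmul a b => simp [mul_assoc, S_mul]
      simp [c, this, contractβ_comul, sandwich_smul_mid]
      rfl
  rw [pR, h1, comul₁_mul_appendOne₃_φinv, h2, h3, counit₃_φinv, zigzag_φ, counit₂_φ]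
  simp [Algebra.TensorProduct.one_def]

/-- `(S ⊗ S)(q_R²¹)`. -/
def qS : H ⊗[k] H := A.SSflip A.qR

theorem SSflip_map_contractα (t : H ⊗[k] (H ⊗[k] H)) :
    A.SSflip (TensorProduct.map LinearMap.id A.contractα t) =
      TensorProduct.comm k H H (TensorProduct.map A.S A.evalα t) := by
  induction t with
  | zero => simp
  | add s t hs ht => simp only [map_add, hs, ht]
  | tmul a u => simp [S_contractα]

/-- `q_S = ∑ S(Y) α Z ⊗ S(X)`, where `φ = ∑ X ⊗ Y ⊗ Z`. -/
theorem qS_eq : A.qS = TensorProduct.comm k H H (TensorProduct.map A.S A.evalα A.φ) :=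
  A.SSflip_map_contractα A.φ

theorem comm_map_mul_comulFst (s : H ⊗[k] (H ⊗[k] H)) (t : H ⊗[k] H) :
    TensorProduct.comm k H H (TensorProduct.map A.S A.evalα (s * A.comulFst t)) =
      sandwich A.comulS (TensorProduct.comm k H H (TensorProduct.map A.S A.evalα s))
        (inl k H).toLinearMap t := by
  induction t with
  | zero => simp
  | add s t hs ht => simp only [map_add, mul_add, hs, ht]
  | tmul a b =>
    simp only [comulFst_tmul, sandwich_tmul, AlgHom.toLinearMap_apply, comulS_apply]
    generalize A.comul a = w
    induction w with
    | zero => simp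
    | add s t hs ht => simp only [map_add, add_mul, mul_add, join_add, hs, ht]
    | tmul c d =>
      induction s using tensor₃_induction with
      | add s t hs ht => simp only [map_add, mul_add, add_mul, hs, ht]
      | tmul x y z => simp [S_mul, mul_assoc]

theorem comm_map_comulSnd_mul (s : H ⊗[k] (H ⊗[k] H)) (t : H ⊗[k] H) :
    TensorProduct.comm k H H (TensorProduct.map A.S A.evalα (A.comulSnd t * s)) =
      TensorProduct.comm k H H (TensorProduct.map A.S A.evalα s) *
        ((1 : H) ⊗ₜ A.S (A.counitSnd t)) := by
  induction t with
  | zero => simp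
  | add s t hs ht => simp only [map_add, add_mul, mul_add, TensorProduct.tmul_add, hs, ht]
  | tmul a b =>
    induction s with
    | zero => simp
    | add s t hs ht => simp only [map_add, add_mul, mul_add, hs, ht]
    | tmul x u => simp [evalα_comul_mul, S_mul]

/-- `q_S (1 ⊗ S(a)) = ∑ (S ⊗ S)(Δᵒᵖ(a₁)) q_S (a₂ ⊗ 1)`. -/
theorem qS_mul (a : H) : A.qS * ((1 : H) ⊗ₜ[k] A.S a) =
    sandwich A.comulS A.qS (inl k H).toLinearMap (A.comul a) := by
  rw [qS_eq, ← comm_map_mul_comulFst, ← comulSnd_comul_mul_φ, comm_map_comulSnd_mul,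
    counitSnd_comul]

/-- `∑ (S ⊗ S)(Δᵒᵖ(p¹)) q_S (p² ⊗ 1) = 1 ⊗ 1`, where `p_R = ∑ p¹ ⊗ p²`. -/
theorem sandwich_qS_pR : sandwich A.comulS A.qS (inl k H).toLinearMap A.pR = 1 := by
  let c : H ⊗[k] (H ⊗[k] (H ⊗[k] H)) →ₗ[k] H ⊗[k] H :=
    (TensorProduct.comm k H H).toLinearMap ∘ₗ TensorProduct.map A.S A.zigzagInv
  have h1 : ∀ s t, sandwich A.comulS
      (TensorProduct.comm k H H (TensorProduct.map A.S A.evalα s)) (inl k H).toLinearMap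
      (TensorProduct.map LinearMap.id A.contractβ t) = c (appendOne₃ k H s * A.comul₁ t) := by
    intro s t
    induction t using tensor₃_induction with
    | add t t' ht ht' => simp only [map_add, mul_add, ht, ht']
    | tmul x y z =>
      simp only [sandwich_tmul, comul₁_tmul, AlgHom.toLinearMap_apply, comulS_apply,
        TensorProduct.map_tmul, LinearMap.id_apply]
      generalize A.comul x = w
      induction w with
      | zero => simp
      | add s t hs ht => simp only [map_add, add_mul, mul_add, join₂_add, hs, ht]
      | tmul a b =>
        induction s using tensor₃_induction with
        | add s t hs ht => simp only [map_add, mul_add, add_mul, hs, ht]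
        | tmul X Y Z => simp [S_mul, mul_assoc, c]
  have h2 : ∀ s t, c (A.comul₂ s * t) = c t * A.SSflip (A.counit₂ s) := by
    intro s t
    induction s using tensor₃_induction with
    | add s s' hs hs' => simp only [map_add, add_mul, mul_add, hs, hs']
    | tmul x y z =>
      induction t with
      | zero => simp
      | add s t hs ht => simp only [map_add, mul_add, add_mul, hs, ht]
      | tmul a u =>
        have : ∀ v, A.zigzagInv (join k H v z * u) =
            sandwich A.S (A.evalα v) A.contractβ u * A.S z := by
          intro v
          induction u using tensor₃_induction with
          | add s s' hs hs' => simp only [map_add, mul_add, add_mul, hs, hs']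
          | tmul b c d =>
            induction v with
            | zero => simp [sandwich]
            | add s t hs ht =>
              simp only [join_add, map_add, add_mul, hs, ht, sandwich_tmul, mul_add]
            | tmul a b => simp [mul_assoc, S_mul]
        simp [c, this, evalα_comul, S_mul, sandwich_smul_mid, TensorProduct.smul_tmul']
        rfl
  have h3 : ∀ s t, c (((1 : H) ⊗ₜ[k] s) * A.comul₃ t) =
      A.SSflip (A.counit₃ t) * (A.zigzagInv s ⊗ₜ[k] (1 : H)) := by
    intro s t
    induction t using tensor₃_induction with
    | add t t' ht ht' => simp only [map_add, mul_add, add_mul, ht, ht']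
    | tmul X Y Z =>
      induction s with
      | zero => simp
      | add s s' hs hs' =>
        simp only [map_add, mul_add, add_mul, TensorProduct.tmul_add, TensorProduct.add_tmul,
          hs, hs']
      | tmul x u => simp [c, contractβ_mul_comul, mul_assoc, S_mul]
  rw [pR, qS_eq, h1, appendOne₃_mul_comul₁_φinv, h2, h3, counit₃_φ, counit₂_φinv, zigzagInv_φinv]
  simp [Algebra.TensorProduct.one_def]

/-- `∑ Δ(q¹) p_R (1 ⊗ S(q²)) = 1 ⊗ 1`, where `q_R = ∑ q¹ ⊗ q²`. -/
theorem sandwich_pR_qR : sandwich A.comul.toLinearMap A.pR A.inrS A.qR = 1 := by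
  rw [← A.sandwich_pR_φ, qR]
  generalize A.φ = t
  induction t with
  | zero => simp
  | add s t hs ht => simp only [map_add, hs, ht]
  | tmul a u => simp [S_contractα]

/-! ### Invariants and intertwiners -/

section Rigid

variable {M : Type*} [AddCommGroup M] [Module k M]

/-- Under a map that turns left multiplication by `Δ(a)` into multiplication by `ε(a)`, the elements
`p_R (a ⊗ 1)` and `p_R (1 ⊗ S(a))` have the same image. -/
theorem pR_mul_inl_of_invariant {F : H ⊗[k] H →ₗ[k] M}
    (hF : ∀ a t, F (A.comul a * t) = A.counit a • F t) (a : H) :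
    F (A.pR * (a ⊗ₜ[k] (1 : H))) = F (A.pR * ((1 : H) ⊗ₜ[k] A.S a)) := by
  rw [pR_mul]
  have : ∀ t, F (sandwich A.comul.toLinearMap A.pR A.inrS t) =
      F (A.pR * ((1 : H) ⊗ₜ A.S (A.counitFst t))) := by
    intro t
    induction t with
    | zero => simp
    | add s t hs ht => simp only [map_add, mul_add, TensorProduct.tmul_add, hs, ht]
    | tmul a b => simp [hF]
  rw [this, counitFst_comul]

/-- An invariant map takes the same value at `p_R (1 ⊗ α)` as at `1 ⊗ 1`. -/
theorem pR_mul_α_of_invariant {F : H ⊗[k] H →ₗ[k] M}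
    (hF : ∀ a t, F (A.comul a * t) = A.counit a • F t) :
    F (A.pR * ((1 : H) ⊗ₜ[k] A.α)) = F 1 := by
  rw [← A.sandwich_pR_φ]
  have : ∀ t, F (sandwich A.comul.toLinearMap A.pR ((inr k H).toLinearMap ∘ₗ A.evalα) t) =
      F (A.pR * ((1 : H) ⊗ₜ A.evalα (A.counit₁ t))) := by
    intro t
    induction t with
    | zero => simp
    | add s t hs ht => simp only [map_add, mul_add, TensorProduct.tmul_add, hs, ht]
    | tmul a b => simp [hF]
  rw [this, counit₁_φ, Algebra.TensorProduct.one_def]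
  simp

/-- One half of the duality that makes an intertwiner determined by its contraction with `α`: the
contraction is undone by `p_R`. -/
theorem α_mul_pR_of_intertwiner {Γ : H ⊗[k] H →ₗ[k] M}
    (hΓ : ∀ a b, Γ (a ⊗ₜ b) = Γ (1 ⊗ₜ (A.S a * b))) :
    Γ (((1 : H) ⊗ₜ[k] A.α) * A.pR) = Γ 1 := by
  have : ∀ t, Γ (((1 : H) ⊗ₜ[k] A.α) * TensorProduct.map LinearMap.id A.contractβ t) =
      Γ (1 ⊗ₜ A.zigzagInv t) := by
    intro t
    induction t with
    | zero => simp
    | add s t hs ht => simp only [map_add, mul_add, TensorProduct.tmul_add, hs, ht]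
    | tmul a b => simp [hΓ a]
  rw [pR, this, zigzagInv_φinv, Algebra.TensorProduct.one_def]

end Rigid

/-! ### Drinfeld's twist -/

/-- The contraction `a ⊗ b ⊗ c ⊗ d ↦ S(b) α c ⊗ S(a) m d`. -/
def evalPair (m : H) : H ⊗[k] (H ⊗[k] (H ⊗[k] H)) →ₗ[k] H ⊗[k] H :=
  sandwich A.SSflip (A.α ⊗ₜ[k] m) LinearMap.id ∘ₗ
    (Algebra.TensorProduct.assoc k k k H H (H ⊗[k] H)).symm.toLinearMap

@[simp] theorem evalPair_tmul (m a b c d : H) : A.evalPair m (a ⊗ₜ (b ⊗ₜ (c ⊗ₜ d))) =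
    (A.S b * (A.α * c)) ⊗ₜ (A.S a * (m * d)) := by
  simp [evalPair]

theorem evalPair_smul (c : k) (m : H) (t : H ⊗[k] (H ⊗[k] (H ⊗[k] H))) :
    A.evalPair (c • m) t = c • A.evalPair m t := by
  simp [evalPair, sandwich_smul_mid]

theorem evalPair_add (m m' : H) (t : H ⊗[k] (H ⊗[k] (H ⊗[k] H))) :
    A.evalPair (m + m') t = A.evalPair m t + A.evalPair m' t := by
  simp [evalPair, TensorProduct.tmul_add, sandwich_add_mid]

theorem evalPair_mul_join₂ (m : H) (s : H ⊗[k] (H ⊗[k] (H ⊗[k] H))) (a b : H ⊗[k] H) :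
    A.evalPair m (s * join₂ k H a b) = A.SSflip a * (A.evalPair m s * b) := by
  induction s using tensor₄_induction with
  | add s t hs ht => simp only [map_add, add_mul, mul_add, hs, ht]
  | tmul x y z w =>
    induction a with
    | zero => simp
    | add s t hs ht => simp only [map_add, add_mul, mul_add, join₂_add, hs, ht]
    | tmul c d =>
      induction b with
      | zero => simp [join₂]
      | add s t hs ht =>
        simp only [map_add, mul_add, join₂_tmul, TensorProduct.tmul_add] at hs ht ⊢
        rw [hs, ht]
      | tmul e f => simp [S_mul, mul_assoc]

theorem γ_eq : A.γ = A.evalPair A.α (((1 : H) ⊗ₜ[k] A.φinv) * A.comul₃ A.φ) := rfl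

/-- A coproduct in the two middle factors is absorbed by `α`. -/
theorem evalPair_comul₂_mul (s : H ⊗[k] (H ⊗[k] H)) (t : H ⊗[k] (H ⊗[k] (H ⊗[k] H))) :
    A.evalPair A.α (A.comul₂ s * t) = A.evalPair (A.evalα (A.counit₂ s)) t := by
  induction s using tensor₃_induction with
  | add s s' hs hs' =>
    simp only [map_add, add_mul, hs, hs', evalPair_add]
  | tmul X Y Z =>
    induction t using tensor₄_induction with
    | add s t hs ht => simp only [map_add, mul_add, hs, ht]
    | tmul a b c d =>
      have : ∀ v, A.evalPair A.α ((X ⊗ₜ join k H v Z) * (a ⊗ₜ (b ⊗ₜ (c ⊗ₜ d)))) =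
          (A.S b * (A.evalα v * c)) ⊗ₜ (A.S a * (A.S X * (A.α * (Z * d)))) := by
        intro v
        induction v with
        | zero => simp
        | add s t hs ht =>
          simp only [join_add, map_add, add_mul, mul_add, TensorProduct.tmul_add,
            TensorProduct.add_tmul, hs, ht]
        | tmul y y' => simp [S_mul, mul_assoc]
      rw [comul₂_tmul, comulFst_tmul, this, evalα_comul]
      simp [TensorProduct.smul_tmul', mul_assoc]

theorem comul₁_comulSnd (t : H ⊗[k] H) :
    A.comul₁ (A.comulSnd t) = A.comul₃ (A.comulFst t) := by
  induction t with
  | zero => simp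
  | add s t hs ht => simp only [map_add, hs, ht]
  | tmul a b =>
    simp only [comulSnd_tmul, comul₁_tmul, comulFst_tmul]
    generalize A.comul a = v
    induction v with
    | zero => simp
    | add s t hs ht => simp only [map_add, join_add, join₂_add, hs, ht]
    | tmul c d => simp

theorem one_tmul_φinv_mul_comul₃_comulSnd (t : H ⊗[k] H) :
    ((1 : H) ⊗ₜ[k] A.φinv) * A.comul₃ (A.comulSnd t) =
      A.comul₂ (A.comulSnd t) * ((1 : H) ⊗ₜ[k] A.φinv) := by
  induction t with
  | zero => simp
  | add s t hs ht => simp only [map_add, mul_add, add_mul, hs, ht]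
  | tmul a b => simp [φinv_mul_comulSnd_comul]

/-- `a ⊗ b ↦ (S ⊗ S)(Δᵒᵖ(a)) γ Δ(b)`. -/
def twistMap : H ⊗[k] H →ₗ[k] H ⊗[k] H := sandwich A.comulS A.γ A.comul.toLinearMap

theorem sandwich_γ (t : H ⊗[k] (H ⊗[k] H)) : sandwich A.comulS A.γ LinearMap.id t =
    A.evalPair A.α ((((1 : H) ⊗ₜ[k] A.φinv) * A.comul₃ A.φ) * A.comul₁ t) := by
  induction t with
  | zero => simp
  | add s t hs ht => simp only [map_add, mul_add, hs, ht]
  | tmul a s => simp [evalPair_mul_join₂, γ_eq, comulS_apply]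

theorem twistMap_eq (t : H ⊗[k] H) :
    A.twistMap t = sandwich A.comulS A.γ LinearMap.id (A.comulSnd t) := by
  induction t with
  | zero => simp
  | add s t hs ht => simp only [map_add, hs, ht]
  | tmul a s => simp [twistMap]

/-- `∑ (S ⊗ S)(Δᵒᵖ(a₁)) γ Δ(a₂) = ε(a) γ`. -/
theorem twistMap_comul (a : H) : A.twistMap (A.comul a) = A.counit a • A.γ := by
  have : A.counit₂ (A.comulSnd (A.comul a)) = A.comul a := by
    have : ∀ t, A.counit₂ (A.comulSnd t) = t := by
      intro t
      induction t with
      | zero => simp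
      | add s t hs ht => simp only [map_add, hs, ht]
      | tmul a b => simp
    exact this _
  rw [twistMap_eq, sandwich_γ, comul₁_comulSnd, mul_assoc, ← map_mul A.comul₃,
    ← comulSnd_comul_mul_φ, map_mul A.comul₃, ← mul_assoc, one_tmul_φinv_mul_comul₃_comulSnd,
    mul_assoc, evalPair_comul₂_mul, this, evalα_comul, evalPair_smul, ← γ_eq]

theorem twistMap_comul_mul (a : H) (t : H ⊗[k] H) :
    A.twistMap (A.comul a * t) = A.counit a • A.twistMap t := by
  have h := A.twistMap_comul a
  rw [twistMap] at h ⊢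
  rw [sandwich_mul A.comulS_mul (by simp), h, sandwich_smul_mid]

theorem twistMap_mul_inl (t : H ⊗[k] H) (a : H) :
    A.twistMap (t * (a ⊗ₜ[k] (1 : H))) = A.comulS a * A.twistMap t := by
  induction t with
  | zero => simp
  | add s t hs ht => simp only [map_add, mul_add, add_mul, hs, ht]
  | tmul c d => simp [twistMap, comulS_mul, mul_assoc]

theorem twistMap_mul_inr (t : H ⊗[k] H) (b : H) :
    A.twistMap (t * ((1 : H) ⊗ₜ[k] b)) = A.twistMap t * A.comul b := by
  induction t with
  | zero => simp
  | add s t hs ht => simp only [map_add, add_mul, hs, ht]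
  | tmul c d => simp [twistMap, mul_assoc]

theorem f_eq : A.f = A.twistMap A.pR := by
  rw [f, pR]
  generalize A.φinv = t
  induction t with
  | zero => simp
  | add s t hs ht => simp only [map_add, hs, ht]
  | tmul c d => simp [twistMap, comulS_apply]

/-- `(S ⊗ S)(Δᵒᵖ(a)) f = f Δ(S(a))`. -/
theorem comulS_mul_f (a : H) : A.comulS a * A.f = A.f * A.comul (A.S a) := by
  rw [f_eq, ← twistMap_mul_inl, ← twistMap_mul_inr,
    A.pR_mul_inl_of_invariant A.twistMap_comul_mul]

theorem f_mul_comul_α : A.f * A.comul A.α = A.γ := by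
  rw [f_eq, ← twistMap_mul_inr, A.pR_mul_α_of_invariant A.twistMap_comul_mul]
  exact sandwich_one A.comulS_one (map_one A.comul) _

/-- `∑ (S ⊗ S)(Δᵒᵖ(X)) γ (Y ⊗ Z) = q_S (1 ⊗ α)`, where `φ = ∑ X ⊗ Y ⊗ Z`. -/
theorem sandwich_γ_φ :
    sandwich A.comulS A.γ LinearMap.id A.φ = A.qS * ((1 : H) ⊗ₜ[k] A.α) := by
  rw [sandwich_γ, mul_assoc, one_tmul_φinv_mul, evalPair_comul₂_mul, counit₂_φ,
    Algebra.TensorProduct.one_def, qS_eq]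
  simp only [evalα_tmul, S_one, one_mul, mul_one]
  generalize A.φ = t
  induction t using tensor₃_induction with
  | add s t hs ht => simp only [map_add, add_mul, hs, ht]
  | tmul a b c => simp

/-! ### The element `U` -/

/-- The antimultiplicative map `Δ ∘ S`. -/
def comulOfS : H →ₗ[k] H ⊗[k] H := A.comul.toLinearMap ∘ₗ A.S

@[simp] theorem comulOfS_apply (a : H) : A.comulOfS a = A.comul (A.S a) := rfl
theorem comulOfS_mul (a b : H) : A.comulOfS (a * b) = A.comulOfS b * A.comulOfS a := by
  simp [S_mul]

/-- `a ⊗ s ↦ Δ(S(a)) m s`. -/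
def actS (m : H ⊗[k] H) : H ⊗[k] (H ⊗[k] H) →ₗ[k] H ⊗[k] H := sandwich A.comulOfS m LinearMap.id

@[simp] theorem actS_tmul (m : H ⊗[k] H) (a : H) (s : H ⊗[k] H) :
    A.actS m (a ⊗ₜ s) = A.comul (A.S a) * (m * s) := by simp [actS]

theorem actS_mul (m : H ⊗[k] H) (s t : H ⊗[k] (H ⊗[k] H)) :
    A.actS m (s * t) = A.actS (A.actS m s) t :=
  sandwich_mul A.comulOfS_mul (fun _ _ => rfl) m s t

theorem actS_comulSnd (a : H) (t : H ⊗[k] H) :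
    A.actS (A.comul a) (A.comulSnd t) =
      A.comul (sandwich A.S a LinearMap.id t) := by
  induction t with
  | zero => simp
  | add s t hs ht => simp only [map_add, hs, ht]
  | tmul c d => simp

/-- `∑ Δ(S(X) α) (Y ⊗ Z)`, where `φ = ∑ X ⊗ Y ⊗ Z`. -/
def evalU : H ⊗[k] H := A.actS (A.comul A.α) A.φ

/-- The element `∑ Δ(S(x₁)) e (x₂ ⊗ y β S(z))` with `e = evalU`: a formula for `U` that does not
involve the twist. -/
def twistFreeU : H ⊗[k] H := A.actS A.evalU (A.comulFst A.pR)

theorem actS_evalU (t : H ⊗[k] (H ⊗[k] H)) :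
    A.actS A.evalU t = A.actS (A.comul A.α) (A.φ * t) := by rw [actS_mul]; rfl

theorem actS_evalU_comulFst_comul_mul (a : H) (t : H ⊗[k] H) :
    A.actS A.evalU (A.comulFst (A.comul a * t)) = A.counit a • A.actS A.evalU (A.comulFst t) := by
  have h : sandwich A.S A.α LinearMap.id (A.comul a) = A.counit a • A.α := A.evalα_comul a
  rw [actS_evalU, map_mul A.comulFst, ← mul_assoc, ← comulSnd_comul_mul_φ, mul_assoc, actS_mul,
    actS_comulSnd, h, map_smul, actS_evalU]
  simp [actS, sandwich_smul_mid]

/-- `U (1 ⊗ S(a)) = ∑ Δ(S(a₁)) U (a₂ ⊗ 1)`, for the formula `twistFreeU` of `U`. -/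
theorem twistFreeU_mul (a : H) :
    A.twistFreeU * ((1 : H) ⊗ₜ[k] A.S a) = A.actS A.twistFreeU (join k H (A.comul a) 1) := by
  have h := A.pR_mul_inl_of_invariant (F := A.actS A.evalU ∘ₗ A.comulFst.toLinearMap)
    (fun a t => A.actS_evalU_comulFst_comul_mul a t) a
  simp only [LinearMap.comp_apply, AlgHom.toLinearMap_apply, map_mul, actS_mul, comulFst_tmul,
    map_one] at h
  rw [← twistFreeU] at h
  simp [h]

theorem twistFreeU_mul_α : A.twistFreeU * ((1 : H) ⊗ₜ[k] A.α) = A.evalU := by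
  have h := A.pR_mul_α_of_invariant (F := A.actS A.evalU ∘ₗ A.comulFst.toLinearMap)
    (fun a t => A.actS_evalU_comulFst_comul_mul a t)
  simp only [LinearMap.comp_apply, AlgHom.toLinearMap_apply, map_mul, actS_mul, comulFst_tmul,
    map_one] at h
  rw [← twistFreeU] at h
  have h1 : ∀ m, A.actS m 1 = m := sandwich_one (by simp) rfl
  simpa [h1] using h

theorem f_mul_actS (m : H ⊗[k] H) (t : H ⊗[k] (H ⊗[k] H)) :
    A.f * A.actS m t = sandwich A.comulS (A.f * m) LinearMap.id t := by
  induction t with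
  | zero => simp
  | add s t hs ht => simp only [map_add, mul_add, hs, ht]
  | tmul a s =>
    simp only [actS_tmul, sandwich_tmul, LinearMap.id_apply]
    rw [← mul_assoc, ← comulS_mul_f]
    simp only [mul_assoc]

theorem sandwich_inl_eq (m : H ⊗[k] H) (t : H ⊗[k] H) :
    sandwich A.comulS m (inl k H).toLinearMap t =
      sandwich A.comulS m LinearMap.id (join k H t 1) := by
  induction t with
  | zero => simp
  | add s t hs ht => simp only [map_add, join_add, hs, ht]
  | tmul a b => simp

/-- An intertwiner of the action `(S ⊗ S)(Δᵒᵖ(a₁)) G (a₂ ⊗ 1)` that is annihilated by `1 ⊗ α`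
vanishes. -/
theorem eq_zero_of_mul_α {G : H ⊗[k] H}
    (hG : ∀ a, G * ((1 : H) ⊗ₜ[k] A.S a) =
      sandwich A.comulS G LinearMap.id (join k H (A.comul a) 1))
    (h : G * ((1 : H) ⊗ₜ[k] A.α) = 0) : G = 0 := by
  have hm := fun m s t => sandwich_mul A.comulS_mul
    (g := (LinearMap.id : H ⊗[k] H →ₗ[k] H ⊗[k] H)) (fun _ _ => rfl) m s t
  have := A.α_mul_pR_of_intertwiner
    (Γ := sandwich A.comulS G LinearMap.id ∘ₗ A.comulFst.toLinearMap) (by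
      intro a b
      have h1 : join k H (A.comul a) b = join k H (A.comul a) 1 * (1 ⊗ₜ (1 ⊗ₜ b)) := by
        rw [← join_one, join_mul, mul_one, one_mul]
      simp only [LinearMap.comp_apply, AlgHom.toLinearMap_apply, comulFst_tmul]
      rw [h1, hm, ← hG]
      simp [mul_assoc])
  simp only [LinearMap.comp_apply, AlgHom.toLinearMap_apply, map_mul, hm, comulFst_tmul,
    map_one] at this
  have h2 : sandwich A.comulS G LinearMap.id (join k H (1 : H ⊗[k] H) A.α) =
      G * ((1 : H) ⊗ₜ[k] A.α) := by
    simp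
  rw [h2, h, sandwich_zero_mid, sandwich_one A.comulS_one rfl] at this
  exact this.symm

/-- Both sides are intertwiners with the same contraction with `1 ⊗ α`. -/
theorem f_mul_twistFreeU : A.f * A.twistFreeU = A.qS := by
  rw [← sub_eq_zero]
  apply A.eq_zero_of_mul_α
  · intro a
    rw [sub_mul, mul_assoc, twistFreeU_mul, f_mul_actS, qS_mul, sandwich_sub_mid, sandwich_inl_eq]
  · rw [sub_mul, mul_assoc, twistFreeU_mul_α, evalU, f_mul_actS, f_mul_comul_α, sandwich_γ_φ,
      sub_self]

/-- The twist has the right inverse `∑ Δ(S(p¹)) U (p² ⊗ 1)`, where `p_R = ∑ p¹ ⊗ p²`. -/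
theorem f_mul_actS_pR : A.f * A.actS A.twistFreeU (appendOne k H A.pR) = 1 := by
  rw [f_mul_actS, f_mul_twistFreeU, appendOne_eq_join, ← sandwich_inl_eq, sandwich_qS_pR]

theorem actS_pR_mul_f [FiniteDimensional k H] :
    A.actS A.twistFreeU (appendOne k H A.pR) * A.f = 1 := by
  have h := A.f_mul_actS_pR
  set g := A.actS A.twistFreeU (appendOne k H A.pR)
  have hinj : Function.Injective (LinearMap.mulLeft k A.f) :=
    LinearMap.injective_iff_surjective.2 fun x => ⟨g * x, by simp [← mul_assoc, h]⟩
  apply hinj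
  simp [← mul_assoc, h]

theorem isUnit_f [FiniteDimensional k H] : IsUnit A.f :=
  ⟨⟨_, _, A.f_mul_actS_pR, A.actS_pR_mul_f⟩, rfl⟩

theorem U_eq [FiniteDimensional k H] : A.U = A.twistFreeU := by
  have h : A.U = Ring.inverse A.f * A.qS := rfl
  rw [h, ← f_mul_twistFreeU, Ring.inverse_mul_cancel_left _ _ A.isUnit_f]

theorem sandwich_pR_mul (s t : H ⊗[k] H) :
    sandwich A.comul.toLinearMap A.pR A.inrS (s * t) =
      sandwich A.comul.toLinearMap (sandwich A.comul.toLinearMap A.pR A.inrS t) A.inrS s :=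
  sandwich_mul' (by simp) A.inrS_mul _ _ _

/-- `φ (Δ ⊗ id)(p_R) = ∑ x ⊗ Δ(y) p_R (1 ⊗ S(z))`, where `φ⁻¹ = ∑ x ⊗ y ⊗ z`. -/
theorem φ_mul_comulFst_pR : A.φ * A.comulFst A.pR =
    TensorProduct.map LinearMap.id (sandwich A.comul.toLinearMap A.pR A.inrS) A.φinv := by
  let c : H ⊗[k] (H ⊗[k] (H ⊗[k] H)) →ₗ[k] H ⊗[k] (H ⊗[k] H) :=
    TensorProduct.map LinearMap.id (TensorProduct.map LinearMap.id A.contractβ)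
  have h1 : ∀ s t, s * A.comulFst (TensorProduct.map LinearMap.id A.contractβ t) =
      c (appendOne₃ k H s * A.comul₁ t) := by
    intro s t
    induction t with
    | zero => simp
    | add t t' ht ht' => simp only [map_add, mul_add, ht, ht']
    | tmul x v =>
      simp only [TensorProduct.map_tmul, LinearMap.id_apply, comulFst_tmul, comul₁_tmul]
      generalize A.comul x = w
      induction w with
      | zero => simp
      | add t t' ht ht' => simp only [map_add, mul_add, join_add, join₂_add, ht, ht']
      | tmul a b =>
        induction s using tensor₃_induction with
        | add s s' hs hs' => simp only [map_add, add_mul, hs, hs']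
        | tmul X Y Z =>
          induction v with
          | zero => simp
          | add s t hs ht =>
            simp only [join_tmul, join₂_tmul, map_add, mul_add, TensorProduct.tmul_add] at hs ht ⊢
            rw [hs, ht]
          | tmul y z => simp [c, mul_assoc]
  have h2 : ∀ t s, c (t * A.comul₃ s) = c t * appendOne k H (A.counit₃ s) := by
    intro t s
    induction s using tensor₃_induction with
    | add s s' hs hs' => simp only [map_add, mul_add, hs, hs']
    | tmul x y z =>
      induction t with
      | zero => simp
      | add s t hs ht => simp only [map_add, add_mul, hs, ht]
      | tmul a u =>
        induction u with
        | zero => simp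
        | add s t hs ht => simp only [map_add, add_mul, TensorProduct.tmul_add, hs, ht]
        | tmul b v => simp [c, contractβ_mul_comul]
  have h3 : ∀ s t, c (A.comul₂ s * ((1 : H) ⊗ₜ[k] t)) = TensorProduct.map LinearMap.id
      (sandwich A.comul.toLinearMap (TensorProduct.map LinearMap.id A.contractβ t) A.inrS) s := by
    intro s t
    induction s with
    | zero => simp
    | add s s' hs hs' => simp only [map_add, add_mul, hs, hs']
    | tmul x u => simp [c, map_contractβ_comulFst_mul]
  rw [pR, h1, appendOne₃_mul_comul₁_φinv, ← mul_assoc, h2, h3, counit₃_φ, map_one, mul_one]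

theorem twistFreeU_eq : A.twistFreeU = A.actS (A.comul A.α)
    (TensorProduct.map LinearMap.id (sandwich A.comul.toLinearMap A.pR A.inrS) A.φinv) := by
  rw [twistFreeU, actS_evalU, φ_mul_comulFst_pR]

theorem actS_twistFreeU_appendOne_mul (s t : H ⊗[k] H) :
    A.actS A.twistFreeU (appendOne k H (s * t)) =
      A.actS (A.actS A.twistFreeU (appendOne k H s)) (appendOne k H t) := by
  rw [map_mul (appendOne k H), actS_mul]

/-- `a ⊗ b ⊗ c ↦ Δ(a β S(b)) U (c ⊗ 1)`. -/
def coevU : H ⊗[k] (H ⊗[k] H) →ₗ[k] H ⊗[k] H :=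
  sandwich A.comul.toLinearMap (A.comul A.β)
    (A.actS A.twistFreeU ∘ₗ (appendOne k H).toLinearMap)

theorem coevU_tmul (a b c : H) : A.coevU (a ⊗ₜ (b ⊗ₜ c)) =
    A.comul (a * (A.β * A.S b)) * (A.twistFreeU * (c ⊗ₜ 1)) := by
  simp [coevU, mul_assoc]

/-- `p_R = ∑ Δ(X β S(Y)) U (Z ⊗ 1)`, where `φ = ∑ X ⊗ Y ⊗ Z`. -/
theorem coevU_φ : A.coevU A.φ = A.pR := by
  let P := sandwich A.comul.toLinearMap A.pR A.inrS
  -- `c` sends `a ⊗ b ⊗ v` to `(a β S(b) α ⊗ 1) v`.  The factors that the pentagon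
  -- identity produces can be taken out of `c` one at a time.
  let c : H ⊗[k] (H ⊗[k] (H ⊗[k] H)) →ₗ[k] H ⊗[k] H :=
    sandwich (inl k H).toLinearMap (A.β ⊗ₜ 1)
      (sandwich ((inl k H).toLinearMap ∘ₗ A.S) (A.α ⊗ₜ 1) LinearMap.id)
  have hc : ∀ a b v, c (a ⊗ₜ (b ⊗ₜ v)) = ((a * (A.β * (A.S b * A.α))) ⊗ₜ[k] (1 : H)) * v := by
    intro a b v
    simp [c, ← mul_assoc]
  have h1 : ∀ s t : H ⊗[k] (H ⊗[k] H),
      sandwich A.comul.toLinearMap (A.comul A.β) (A.actS (A.actS (A.comul A.α)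
        (TensorProduct.map LinearMap.id P t)) ∘ₗ (appendOne k H).toLinearMap) s =
      P (c (((1 : H) ⊗ₜ[k] t) * A.comul₃ s)) := by
    intro s t
    induction s using tensor₃_induction with
    | add s s' hs hs' => simp only [map_add, mul_add, hs, hs']
    | tmul X Y Z =>
      induction t using tensor₃_induction with
      | add s t hs ht =>
        simp only [map_add, mul_add, add_mul, sandwich_tmul, LinearMap.comp_apply,
          AlgHom.toLinearMap_apply, appendOne_tmul, actS_tmul, TensorProduct.tmul_add] at hs ht ⊢
        rw [hs, ht]
      | tmul x y z =>
        have h : P (A.comul Z) = A.pR * (Z ⊗ₜ 1) := (A.pR_mul Z).symm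
        have h2 : ∀ s t, P (s * t) = sandwich A.comul.toLinearMap (P t) A.inrS s :=
          A.sandwich_pR_mul
        have h3 : P (c (((1 : H) ⊗ₜ[k] (x ⊗ₜ[k] (y ⊗ₜ[k] z))) * A.comul₃ (X ⊗ₜ (Y ⊗ₜ Z)))) =
            A.comul (X * (A.β * (A.S (x * Y) * (A.α * y)))) *
              (A.pR * (Z ⊗ₜ 1) * (1 ⊗ₜ A.S z)) := by
          simp only [comul₃_tmul, comulSnd_tmul, Algebra.TensorProduct.tmul_mul_tmul, one_mul, hc]
          rw [← mul_assoc, h2, h]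
          simp [mul_assoc]
        rw [h3]
        simp [P, S_mul, mul_assoc]
  have h2 : ∀ s t, c (A.comul₂ s * t) = A.counit₂ s * c t := by
    intro s t
    induction s using tensor₃_induction with
    | add s s' hs hs' => simp only [map_add, add_mul, hs, hs']
    | tmul X Y Z =>
      induction t using tensor₄_induction with
      | add s t hs ht => simp only [map_add, mul_add, hs, ht]
      | tmul a b d e =>
        have : ∀ v, c ((X ⊗ₜ join k H v Z) * (a ⊗ₜ (b ⊗ₜ (d ⊗ₜ e)))) =
            (X * (a * (A.β * (A.S b * (A.evalα v * d))))) ⊗ₜ (Z * e) := by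
          intro v
          induction v with
          | zero => simp
          | add s t hs ht =>
            simp only [join_add, map_add, add_mul, mul_add, TensorProduct.tmul_add,
              TensorProduct.add_tmul, hs, ht]
          | tmul y y' => simp [hc, S_mul, mul_assoc]
        rw [comul₂_tmul, comulFst_tmul, this, evalα_comul]
        simp [hc, mul_assoc, TensorProduct.smul_tmul']
  have h3 : ∀ s t, c (appendOne₃ k H s * A.comul₁ t) =
      (A.zigzag s ⊗ₜ 1) * A.counit₁ t := by
    intro s t
    induction t using tensor₃_induction with
    | add t t' ht ht' => simp only [map_add, mul_add, ht, ht']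
    | tmul x y z =>
      induction s using tensor₃_induction with
      | add s s' hs hs' => simp only [map_add, add_mul, TensorProduct.add_tmul, hs, hs']
      | tmul X Y Z =>
        have : ∀ v, c (appendOne₃ k H (X ⊗ₜ (Y ⊗ₜ Z)) * join₂ k H v (y ⊗ₜ z)) =
            (X * (A.contractβ v * (A.S Y * (A.α * (Z * y))))) ⊗ₜ z := by
          intro v
          induction v with
          | zero => simp
          | add s t hs ht =>
            simp only [join₂_add, map_add, add_mul, mul_add, TensorProduct.add_tmul, hs, ht]
          | tmul y y' => simp [hc, S_mul, mul_assoc]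
        rw [comul₁_tmul, this, contractβ_comul]
        simp [mul_assoc, TensorProduct.smul_tmul']
  have h4 : P 1 = A.pR := sandwich_one (map_one A.comul) (by
    simp [Algebra.TensorProduct.one_def]) _
  rw [coevU, twistFreeU_eq, h1, one_tmul_φinv_mul_comul₃, h2, h3, counit₂_φ, zigzag_φ, counit₁_φinv,
    ← Algebra.TensorProduct.one_def, one_mul, one_mul, h4]

theorem counitFst_map_contractβ (t : H ⊗[k] (H ⊗[k] H)) :
    A.counitFst (TensorProduct.map LinearMap.id A.contractβ t) = A.contractβ (A.counit₁ t) := by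
  induction t with
  | zero => simp
  | add s t hs ht => simp only [map_add, hs, ht]
  | tmul a b => simp

theorem counitFst_pR : A.counitFst A.pR = A.β := by
  rw [pR, counitFst_map_contractβ, counit₁_φinv, Algebra.TensorProduct.one_def]
  simp

theorem counitSnd_qR : A.counitSnd A.qR = A.counit A.α • 1 := by
  have h : ∀ s, A.counitSnd (TensorProduct.map LinearMap.id A.contractα s) =
      A.counit A.α • A.counitSnd (A.counit₂ s) := by
    intro s
    induction s using tensor₃_induction with
    | add s t hs ht => simp only [map_add, smul_add, hs, ht]
    | tmul a b c => 
      simp only [contractα, TensorProduct.map_tmul, LinearMap.comp_apply, LinearEquiv.coe_coe,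
        TensorProduct.comm_tmul, LinearMap.mul'_apply, LinearMap.mulLeft_apply,
        LinearMap.id_apply, counitSnd_tmul, map_mul, counit_Sinv, counit₂_tmul]
      simp [smul_smul, mul_comm, mul_left_comm]
  rw [qR, h, counit₂_φ, map_one]

/-- A coproduct in the first two factors is absorbed by `β`. -/
theorem coevU_mul_comulFst (s : H ⊗[k] (H ⊗[k] H)) (t : H ⊗[k] H) :
    A.coevU (s * A.comulFst t) = A.coevU s * (A.counitFst t ⊗ₜ 1) := by
  induction t with
  | zero => simp
  | add t t' ht ht' => simp only [map_add, mul_add, TensorProduct.add_tmul, ht, ht']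
  | tmul p q =>
    induction s using tensor₃_induction with
    | add s s' hs hs' => simp only [map_add, add_mul, hs, hs']
    | tmul X Y Z =>
      have : ∀ v, A.coevU ((X ⊗ₜ (Y ⊗ₜ Z)) * join k H v q) =
          A.comul (X * (A.contractβ v * A.S Y)) * (A.twistFreeU * ((Z * q) ⊗ₜ 1)) := by
        intro v
        induction v with
        | zero => simp
        | add s t hs ht => simp only [join_add, map_add, add_mul, mul_add, hs, ht]
        | tmul y y' =>
          rw [join_tmul, Algebra.TensorProduct.tmul_mul_tmul, Algebra.TensorProduct.tmul_mul_tmul,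
            coevU_tmul]
          simp only [contractβ_tmul, S_mul, mul_assoc]
      rw [comulFst_tmul, this, contractβ_comul, coevU_tmul]
      simp [mul_assoc, ← TensorProduct.smul_tmul']

theorem actS_twistFreeU_comul_mul (y z : H) (s : H ⊗[k] H) :
    A.actS A.twistFreeU (appendOne k H (A.comul y * (s * ((1 : H) ⊗ₜ[k] A.S z)))) =
      A.actS A.twistFreeU (appendOne k H s) * (A.S z ⊗ₜ[k] A.S y) := by
  rw [actS_twistFreeU_appendOne_mul, appendOne_eq_join (A.comul y), ← twistFreeU_mul]
  induction s with
  | zero => simp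
  | add s t hs ht => simp only [map_add, add_mul, hs, ht]
  | tmul a b => simp [mul_assoc]

/-- `∑ Δ(x β) f⁻¹ (S(z) ⊗ S(y)) = p_R (β ⊗ 1)`, where `φ⁻¹ = ∑ x ⊗ y ⊗ z` and `f⁻¹` is written
through `U`. -/
theorem sandwich_SSflip_φinv : sandwich A.comul.toLinearMap
    (A.comul A.β * A.actS A.twistFreeU (appendOne k H A.pR)) A.SSflip A.φinv =
      A.pR * (A.β ⊗ₜ 1) := by
  have h : ∀ t, sandwich A.comul.toLinearMap
      (A.comul A.β * A.actS A.twistFreeU (appendOne k H A.pR)) A.SSflip t =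
      A.coevU (TensorProduct.map LinearMap.id
        (sandwich A.comul.toLinearMap A.pR A.inrS) t) := by
    intro t
    induction t using tensor₃_induction with
    | add s t hs ht => simp only [map_add, hs, ht]
    | tmul x y z =>
      simp only [TensorProduct.map_tmul, LinearMap.id_apply, sandwich_tmul, coevU,
        LinearMap.comp_apply, AlgHom.toLinearMap_apply, inrS_apply, actS_twistFreeU_comul_mul,
        SSflip_tmul, mul_assoc]
  rw [h, ← φ_mul_comulFst_pR, coevU_mul_comulFst, coevU_φ, counitFst_pR]

/-! ### The element `V` -/

/-- `a ⊗ s ↦ s m Δ(S⁻¹(a))`. -/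
def actSinv (m : H ⊗[k] H) : H ⊗[k] (H ⊗[k] H) →ₗ[k] H ⊗[k] H :=
  sandwich LinearMap.id m (A.comul.toLinearMap ∘ₗ A.Sinv) ∘ₗ
    (Algebra.TensorProduct.comm k H (H ⊗[k] H)).toLinearMap

@[simp] theorem actSinv_tmul (m : H ⊗[k] H) (a : H) (s : H ⊗[k] H) :
    A.actSinv m (a ⊗ₜ s) = s * (m * A.comul (A.Sinv a)) := by simp [actSinv]

theorem actSinv_mul (m : H ⊗[k] H) (s t : H ⊗[k] (H ⊗[k] H)) :
    A.actSinv m (s * t) = A.actSinv (A.actSinv m t) s := by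
  simp only [actSinv, LinearMap.comp_apply, AlgEquiv.toLinearMap_apply]
  rw [map_mul (Algebra.TensorProduct.comm k H (H ⊗[k] H)),
    sandwich_mul' (fun _ _ => rfl) (by simp [Sinv_mul])]

/-- `∑ (y ⊗ z) Δ(S⁻¹(x β))`, where `φ⁻¹ = ∑ x ⊗ y ⊗ z`. -/
def evalV : H ⊗[k] H := A.actSinv (A.comul (A.Sinv A.β)) A.φinv

/-- `V = (S⁻¹ ⊗ S⁻¹)((f p_R)²¹)`. -/
theorem V_eq : A.V = A.SinvSinvFlip (A.f * A.pR) := by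
  rw [SinvSinvFlip_mul]; rfl

theorem f_mul_comul (a : H) : A.f * A.comul a = A.comulS (A.Sinv a) * A.f := by
  rw [comulS_mul_f, S_Sinv]

theorem SinvSinvFlip_comulS (a : H) : A.SinvSinvFlip (A.comulS a) = A.comul a := by
  rw [comulS_apply, SinvSinvFlip_SSflip]

/-- `(1 ⊗ S⁻¹(a)) V = ∑ (a₂ ⊗ 1) V Δ(S⁻¹(a₁))`. -/
theorem mul_V (a : H) : ((1 : H) ⊗ₜ[k] A.Sinv a) * A.V =
    A.actSinv A.V (join k H (A.comul a) 1) := by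
  have h1 : (1 : H) ⊗ₜ[k] A.Sinv a = A.SinvSinvFlip (a ⊗ₜ 1) := by simp
  rw [h1, V_eq, ← SinvSinvFlip_mul, mul_assoc, pR_mul, ← V_eq]
  generalize A.comul a = t
  induction t with
  | zero => simp
  | add s t hs ht => simp only [map_add, mul_add, join_add, hs, ht]
  | tmul b c =>
    simp only [sandwich_tmul, AlgHom.toLinearMap_apply, inrS_apply, join_tmul, actSinv_tmul]
    rw [← mul_assoc, f_mul_comul, mul_assoc, ← mul_assoc A.f, SinvSinvFlip_mul, SinvSinvFlip_mul,
      SinvSinvFlip_comulS, ← V_eq, mul_assoc]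
    simp

theorem β_mul_V : ((1 : H) ⊗ₜ[k] A.Sinv A.β) * A.V = A.evalV := by
  have h1 : (1 : H) ⊗ₜ[k] A.Sinv A.β = A.SinvSinvFlip (A.β ⊗ₜ 1) := by simp
  rw [h1, V_eq, ← SinvSinvFlip_mul, mul_assoc, ← sandwich_SSflip_φinv, evalV]
  have : ∀ t, A.SinvSinvFlip (A.f * sandwich A.comul.toLinearMap
      (A.comul A.β * A.actS A.twistFreeU (appendOne k H A.pR)) A.SSflip t) =
      A.actSinv (A.comul (A.Sinv A.β)) t := by
    intro t
    induction t with
    | zero => simp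
    | add s t hs ht => simp only [map_add, mul_add, hs, ht]
    | tmul x s =>
      have h2 : A.f * (A.comul x * (A.comul A.β * A.actS A.twistFreeU (appendOne k H A.pR) *
          A.SSflip s)) = A.comulS (A.Sinv (x * A.β)) * A.SSflip s := by
        calc _ = A.f * A.comul (x * A.β) * A.actS A.twistFreeU (appendOne k H A.pR) *
              A.SSflip s := by rw [map_mul]; simp only [mul_assoc]
          _ = _ := by
            rw [f_mul_comul, mul_assoc (A.comulS _), f_mul_actS_pR, mul_one]
      rw [sandwich_tmul, AlgHom.toLinearMap_apply, h2, SinvSinvFlip_mul, SinvSinvFlip_comulS,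
        SinvSinvFlip_SSflip, actSinv_tmul, Sinv_mul, map_mul]
  exact this _

/-! ### Compatibility of `U` and `V` with the reassociator -/

theorem appendOne_mul_one_tmul (t : H ⊗[k] H) (b : H) :
    appendOne k H t * ((1 : H) ⊗ₜ[k] ((1 : H) ⊗ₜ[k] b)) =
      ((1 : H) ⊗ₜ[k] ((1 : H) ⊗ₜ[k] b)) * appendOne k H t := by
  induction t with
  | zero => simp
  | add s t hs ht => simp only [map_add, mul_add, add_mul, hs, ht]
  | tmul x y => simp

theorem comul₂_appendOne (t : H ⊗[k] H) :
    A.comul₂ (appendOne k H t) = appendOne₃ k H (A.comulSnd t) := by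
  induction t with
  | zero => simp
  | add s t hs ht => simp only [map_add, hs, ht]
  | tmul x y => simp [appendOne_eq_join]

theorem appendOne₃_comulFst (t : H ⊗[k] H) :
    appendOne₃ k H (A.comulFst t) = A.comul₁ (appendOne k H t) := by
  induction t with
  | zero => simp
  | add s t hs ht => simp only [map_add, hs, ht]
  | tmul x y =>
    simp only [comulFst_tmul, appendOne_tmul, comul₁_tmul]
    generalize A.comul x = v
    induction v with
    | zero => simp
    | add s t hs ht => simp only [map_add, join_add, join₂_add, hs, ht]
    | tmul c d => simp

theorem comul₃_appendOne_mul (t v : H ⊗[k] H) :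
    A.comul₃ (appendOne k H t) * ((1 : H) ⊗ₜ[k] ((1 : H) ⊗ₜ[k] v)) = join₂ k H t v := by
  induction t with
  | zero => simp
  | add s t hs ht => simp only [map_add, add_mul, join₂_add, hs, ht]
  | tmul x y => simp

theorem mul_comul₃_appendOne (t v : H ⊗[k] H) :
    ((1 : H) ⊗ₜ[k] ((1 : H) ⊗ₜ[k] v)) * A.comul₃ (appendOne k H t) = join₂ k H t v := by
  induction t with
  | zero => simp
  | add s t hs ht => simp only [map_add, mul_add, join₂_add, hs, ht]
  | tmul x y => simp

/-- The antimultiplicative map `(Δ ⊗ id) Δ S`. -/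
def comulComulS : H →ₗ[k] H ⊗[k] (H ⊗[k] H) := A.comulFst.toLinearMap ∘ₗ A.comulOfS

/-- `a ⊗ s ↦ (Δ ⊗ id)(Δ(S(a))) m s`. -/
def actS₃ (m : H ⊗[k] (H ⊗[k] H)) :
    H ⊗[k] (H ⊗[k] (H ⊗[k] H)) →ₗ[k] H ⊗[k] (H ⊗[k] H) :=
  sandwich A.comulComulS m LinearMap.id

@[simp] theorem actS₃_tmul (m : H ⊗[k] (H ⊗[k] H)) (a : H) (s : H ⊗[k] (H ⊗[k] H)) :
    A.actS₃ m (a ⊗ₜ s) = A.comulFst (A.comul (A.S a)) * (m * s) := by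
  simp [actS₃, comulComulS]

theorem actS₃_mul (m : H ⊗[k] (H ⊗[k] H)) (s t : H ⊗[k] (H ⊗[k] (H ⊗[k] H))) :
    A.actS₃ m (s * t) = A.actS₃ (A.actS₃ m s) t :=
  sandwich_mul (by simp [comulComulS, S_mul]) (fun _ _ => rfl) m s t

theorem actS₃_one (m : H ⊗[k] (H ⊗[k] H)) : A.actS₃ m 1 = m :=
  sandwich_one (by simp [comulComulS]) rfl m

theorem actS₃_sub (m m' : H ⊗[k] (H ⊗[k] H)) (t : H ⊗[k] (H ⊗[k] (H ⊗[k] H))) :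
    A.actS₃ (m - m') t = A.actS₃ m t - A.actS₃ m' t :=
  sandwich_sub_mid _ _ _ _ _

theorem comulFst_actS (m : H ⊗[k] H) (t : H ⊗[k] (H ⊗[k] H)) :
    A.comulFst (A.actS m t) = A.actS₃ (A.comulFst m) (A.comul₂ t) := by
  induction t with
  | zero => simp
  | add s t hs ht => simp only [map_add, hs, ht]
  | tmul a s => simp

theorem φinv_mul_comulSnd_actS (m : H) (t : H ⊗[k] (H ⊗[k] H)) :
    A.φinv * A.comulSnd (A.actS (A.comul m) t) =
      A.actS₃ (A.comulFst (A.comul m)) (((1 : H) ⊗ₜ[k] A.φinv) * A.comul₃ t) := by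
  induction t with
  | zero => simp
  | add s t hs ht => simp only [map_add, mul_add, hs, ht]
  | tmul a s =>
    have h : A.φinv * A.comulSnd (A.comul (A.S a * m) * s) =
        A.comulFst (A.comul (A.S a * m)) * (A.φinv * A.comulSnd s) := by
      rw [map_mul A.comulSnd, ← mul_assoc, φinv_mul_comulSnd_comul, mul_assoc]
    simpa [mul_assoc] using h

theorem actS₃_appendOne₃_mul (m : H ⊗[k] (H ⊗[k] H)) (t : H ⊗[k] (H ⊗[k] H)) (b : H) :
    A.actS₃ m (appendOne₃ k H t) * ((1 : H) ⊗ₜ[k] ((1 : H) ⊗ₜ[k] b)) =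
      A.actS₃ (m * ((1 : H) ⊗ₜ[k] ((1 : H) ⊗ₜ[k] b))) (appendOne₃ k H t) := by
  induction t with
  | zero => simp
  | add s t hs ht => simp only [map_add, add_mul, hs, ht]
  | tmul a s => simp only [appendOne₃_tmul, actS₃_tmul, mul_assoc, appendOne_mul_one_tmul]

theorem actS₃_mul_right (m : H ⊗[k] (H ⊗[k] H)) (t : H ⊗[k] (H ⊗[k] (H ⊗[k] H)))
    (s : H ⊗[k] (H ⊗[k] H)) : A.actS₃ m (t * ((1 : H) ⊗ₜ s)) = A.actS₃ m t * s := by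
  rw [actS₃_mul]; simp

theorem actS_appendOne_mul (m : H ⊗[k] H) (t : H ⊗[k] H) (b : H) :
    A.actS m (appendOne k H t) * ((1 : H) ⊗ₜ[k] b) =
      A.actS (m * ((1 : H) ⊗ₜ[k] b)) (appendOne k H t) := by
  induction t with
  | zero => simp
  | add s t hs ht => simp only [map_add, add_mul, hs, ht]
  | tmul a s => simp [mul_assoc]

/-- An intertwiner in `H ⊗ H ⊗ H` that is annihilated by `1 ⊗ 1 ⊗ α` vanishes. -/
theorem eq_zero_of_mul_α₃ {G : H ⊗[k] (H ⊗[k] H)}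
    (hG : ∀ a, G * ((1 : H) ⊗ₜ[k] ((1 : H) ⊗ₜ[k] A.S a)) =
      A.actS₃ G (A.comul₁ (appendOne k H (A.comul a))))
    (h : G * ((1 : H) ⊗ₜ[k] ((1 : H) ⊗ₜ[k] A.α)) = 0) : G = 0 := by
  have h0 : ∀ b : H, A.comul₁ (A.comulFst ((1 : H) ⊗ₜ[k] b)) =
      (1 : H) ⊗ₜ ((1 : H) ⊗ₜ ((1 : H) ⊗ₜ b)) := by
    intro b
    rw [comulFst_tmul, map_one, join_one, comul₁_tmul, map_one, Algebra.TensorProduct.one_def,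
      join₂_tmul]
  have h1 : ∀ a : H, A.comulFst (a ⊗ₜ[k] (1 : H)) = appendOne k H (A.comul a) := fun a => rfl
  have := A.α_mul_pR_of_intertwiner
    (Γ := A.actS₃ G ∘ₗ (A.comul₁.comp A.comulFst).toLinearMap) (by
      intro a b
      have h2 : a ⊗ₜ[k] b = (a ⊗ₜ 1) * (1 ⊗ₜ b) := by simp
      simp only [LinearMap.comp_apply, AlgHom.toLinearMap_apply, AlgHom.comp_apply]
      rw [h2, map_mul A.comulFst, map_mul A.comul₁, actS₃_mul, h1, ← hG, h0, h0]
      simp [mul_assoc])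
  simp only [LinearMap.comp_apply, AlgHom.toLinearMap_apply, AlgHom.comp_apply, map_one,
    actS₃_one, map_mul, actS₃_mul, h0] at this
  rw [← this]
  have h3 : A.actS₃ G ((1 : H) ⊗ₜ ((1 : H) ⊗ₜ ((1 : H) ⊗ₜ A.α))) = 0 := by simp [h]
  rw [h3, actS₃, sandwich_zero_mid]

/-- `φ⁻¹ (id ⊗ Δ)(U) (1 ⊗ U) = ∑ (Δ ⊗ id)(Δ(S(X)) U) (Y ⊗ Z ⊗ 1)`. -/
theorem φinv_mul_comulSnd_twistFreeU :
    A.φinv * A.comulSnd A.twistFreeU * ((1 : H) ⊗ₜ[k] A.twistFreeU) =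
      A.actS₃ (A.comulFst A.twistFreeU) (appendOne₃ k H A.φ) := by
  set u := A.twistFreeU with hu
  set G := A.φinv * A.comulSnd u * ((1 : H) ⊗ₜ[k] u) with hG
  -- Both sides are intertwiners; by the pentagon identity they have the same contraction with `α`.
  have hum : ∀ a, u * ((1 : H) ⊗ₜ[k] A.S a) = A.actS u (appendOne k H (A.comul a)) :=
    A.twistFreeU_mul
  have hR : ∀ a : H, ∀ s : H ⊗[k] H, A.comulSnd u * ((1 : H) ⊗ₜ[k] (A.comul (A.S a) * s)) =
      A.comulSnd (A.actS u (appendOne k H (A.comul a))) * ((1 : H) ⊗ₜ[k] s) := by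
    intro a s
    rw [← hum, map_mul, mul_assoc]
    simp
  rw [← sub_eq_zero]
  apply A.eq_zero_of_mul_α₃
  · intro a
    have e1 : ∀ t, A.φinv * A.comulSnd u * ((1 : H) ⊗ₜ[k] A.actS u (appendOne k H t)) =
        A.actS₃ G (A.comul₁ (appendOne k H t)) := by
      intro t
      induction t with
      | zero => simp
      | add s t hs ht => simp only [map_add, TensorProduct.tmul_add, mul_add, hs, ht]
      | tmul a b =>
        have e2 : ∀ t, A.φinv * (A.comulSnd (A.actS u (appendOne k H t)) *
            ((1 : H) ⊗ₜ[k] (u * (b ⊗ₜ 1)))) = A.actS₃ G (join₂ k H t (b ⊗ₜ 1)) := by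
          intro t
          induction t with
          | zero => simp
          | add s t hs ht => simp only [map_add, add_mul, mul_add, join₂_add, hs, ht]
          | tmul p q =>
            rw [appendOne_tmul, actS_tmul, map_mul, ← mul_assoc, ← mul_assoc,
              φinv_mul_comulSnd_comul, join₂_tmul, actS₃_tmul, map_mul]
            simp [hG, mul_assoc]
        rw [appendOne_tmul, actS_tmul, mul_assoc, hR, e2, comul₁_tmul]
    have e3 : G * ((1 : H) ⊗ₜ[k] ((1 : H) ⊗ₜ[k] A.S a)) =
        A.actS₃ G (A.comul₁ (appendOne k H (A.comul a))) := by
      rw [← e1, ← hum, hG, mul_assoc]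
      simp
    have e4 : A.actS₃ (A.comulFst u) (appendOne₃ k H A.φ) *
        ((1 : H) ⊗ₜ[k] ((1 : H) ⊗ₜ[k] A.S a)) =
        A.actS₃ (A.actS₃ (A.comulFst u) (appendOne₃ k H A.φ))
          (A.comul₁ (appendOne k H (A.comul a))) := by
      have e5 : A.comulFst u * ((1 : H) ⊗ₜ[k] ((1 : H) ⊗ₜ[k] A.S a)) =
          A.comulFst (u * ((1 : H) ⊗ₜ[k] A.S a)) := by
        rw [map_mul, comulFst_tmul, map_one, join_one]
      rw [actS₃_appendOne₃_mul, e5, hum, comulFst_actS, ← actS₃_mul, comul₂_appendOne, ← map_mul,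
        comulSnd_comul_mul_φ, map_mul, actS₃_mul, appendOne₃_comulFst]
    rw [sub_mul, e3, e4, actS₃_sub]
  · have e1 : ∀ s, A.φinv * A.comulSnd u * ((1 : H) ⊗ₜ[k] A.actS (A.comul A.α) s) =
        A.actS₃ (A.comulFst (A.comul A.α))
          (((1 : H) ⊗ₜ[k] A.φinv) * (A.comul₃ A.φ * A.comul₁ s)) := by
      intro s
      induction s with
      | zero => simp
      | add s t hs ht => simp only [map_add, TensorProduct.tmul_add, mul_add, hs, ht]
      | tmul a v =>
        have e2 : A.comulSnd (A.actS u (appendOne k H (A.comul a))) *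
            ((1 : H) ⊗ₜ[k] (A.comul A.α * v)) =
            A.comulSnd (A.actS (A.comul A.α) (A.φ * appendOne k H (A.comul a))) *
              ((1 : H) ⊗ₜ[k] v) := by
          rw [← actS_evalU, ← twistFreeU_mul_α, ← actS_appendOne_mul, map_mul, mul_assoc]
          simp [hu]
        rw [actS_tmul, mul_assoc, hR, e2, ← mul_assoc, φinv_mul_comulSnd_actS, ← actS₃_mul_right,
          map_mul A.comul₃, mul_assoc, mul_assoc, comul₃_appendOne_mul, comul₁_tmul]
    have e3 : G * ((1 : H) ⊗ₜ[k] ((1 : H) ⊗ₜ[k] A.α)) =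
        A.actS₃ (A.comulFst (A.comul A.α)) (A.comul₂ A.φ * appendOne₃ k H A.φ) := by
      rw [← one_tmul_φinv_mul, ← e1, ← evalU, ← twistFreeU_mul_α, hG, mul_assoc]
      simp [hu]
    have e4 : A.actS₃ (A.comulFst u) (appendOne₃ k H A.φ) *
        ((1 : H) ⊗ₜ[k] ((1 : H) ⊗ₜ[k] A.α)) =
        A.actS₃ (A.comulFst (A.comul A.α)) (A.comul₂ A.φ * appendOne₃ k H A.φ) := by
      have e5 : A.comulFst u * ((1 : H) ⊗ₜ[k] ((1 : H) ⊗ₜ[k] A.α)) =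
          A.comulFst (u * ((1 : H) ⊗ₜ[k] A.α)) := by
        rw [map_mul, comulFst_tmul, map_one, join_one]
      rw [actS₃_appendOne₃_mul, e5, twistFreeU_mul_α, evalU, comulFst_actS, ← actS₃_mul]
    rw [sub_mul, e3, e4, sub_self]

/-- `a ⊗ s ↦ s m (Δ ⊗ id)(Δ(S⁻¹(a)))`. -/
def actSinv₃ (m : H ⊗[k] (H ⊗[k] H)) :
    H ⊗[k] (H ⊗[k] (H ⊗[k] H)) →ₗ[k] H ⊗[k] (H ⊗[k] H) :=
  sandwich LinearMap.id m (A.comulFst.toLinearMap ∘ₗ A.comul.toLinearMap ∘ₗ A.Sinv) ∘ₗ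
    (Algebra.TensorProduct.comm k H (H ⊗[k] (H ⊗[k] H))).toLinearMap

@[simp] theorem actSinv₃_tmul (m : H ⊗[k] (H ⊗[k] H)) (a : H) (s : H ⊗[k] (H ⊗[k] H)) :
    A.actSinv₃ m (a ⊗ₜ s) = s * (m * A.comulFst (A.comul (A.Sinv a))) := by simp [actSinv₃]

theorem actSinv₃_mul (m : H ⊗[k] (H ⊗[k] H)) (s t : H ⊗[k] (H ⊗[k] (H ⊗[k] H))) :
    A.actSinv₃ m (s * t) = A.actSinv₃ (A.actSinv₃ m t) s := by
  simp only [actSinv₃, LinearMap.comp_apply, AlgEquiv.toLinearMap_apply]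
  rw [map_mul (Algebra.TensorProduct.comm k H (H ⊗[k] (H ⊗[k] H))),
    sandwich_mul' (fun _ _ => rfl) (by simp [Sinv_mul])]

theorem actSinv₃_one (m : H ⊗[k] (H ⊗[k] H)) : A.actSinv₃ m 1 = m := by
  rw [Algebra.TensorProduct.one_def]; simp

theorem actSinv₃_sub (m m' : H ⊗[k] (H ⊗[k] H)) (t : H ⊗[k] (H ⊗[k] (H ⊗[k] H))) :
    A.actSinv₃ (m - m') t = A.actSinv₃ m t - A.actSinv₃ m' t := by
  simp [actSinv₃, sandwich_sub_mid]

theorem actSinv₃_mul_left (m : H ⊗[k] (H ⊗[k] H)) (t : H ⊗[k] (H ⊗[k] (H ⊗[k] H)))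
    (s : H ⊗[k] (H ⊗[k] H)) : A.actSinv₃ m (((1 : H) ⊗ₜ s) * t) = s * A.actSinv₃ m t := by
  rw [actSinv₃_mul]; simp

theorem comulFst_actSinv (m : H ⊗[k] H) (t : H ⊗[k] (H ⊗[k] H)) :
    A.comulFst (A.actSinv m t) = A.actSinv₃ (A.comulFst m) (A.comul₂ t) := by
  induction t with
  | zero => simp
  | add s t hs ht => simp only [map_add, hs, ht]
  | tmul a s => simp

theorem comulSnd_actSinv_mul_φ (m : H) (t : H ⊗[k] (H ⊗[k] H)) :
    A.comulSnd (A.actSinv (A.comul m) t) * A.φ =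
      A.actSinv₃ (A.comulFst (A.comul m)) (A.comul₃ t * ((1 : H) ⊗ₜ[k] A.φ)) := by
  induction t with
  | zero => simp
  | add s t hs ht => simp only [map_add, add_mul, hs, ht]
  | tmul a s =>
    have h : A.comulSnd (s * A.comul (m * A.Sinv a)) * A.φ =
        A.comulSnd s * (A.φ * A.comulFst (A.comul (m * A.Sinv a))) := by
      rw [map_mul A.comulSnd, mul_assoc, comulSnd_comul_mul_φ]
    simpa [mul_assoc] using h

theorem mul_actSinv₃_appendOne₃ (m : H ⊗[k] (H ⊗[k] H)) (t : H ⊗[k] (H ⊗[k] H)) (b : H) :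
    ((1 : H) ⊗ₜ[k] ((1 : H) ⊗ₜ[k] b)) * A.actSinv₃ m (appendOne₃ k H t) =
      A.actSinv₃ (((1 : H) ⊗ₜ[k] ((1 : H) ⊗ₜ[k] b)) * m) (appendOne₃ k H t) := by
  induction t with
  | zero => simp
  | add s t hs ht => simp only [map_add, mul_add, hs, ht]
  | tmul a s =>
    simp only [appendOne₃_tmul, actSinv₃_tmul, ← mul_assoc, appendOne_mul_one_tmul]

theorem mul_actSinv_appendOne (m : H ⊗[k] H) (t : H ⊗[k] H) (b : H) :
    ((1 : H) ⊗ₜ[k] b) * A.actSinv m (appendOne k H t) =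
      A.actSinv (((1 : H) ⊗ₜ[k] b) * m) (appendOne k H t) := by
  induction t with
  | zero => simp
  | add s t hs ht => simp only [map_add, mul_add, hs, ht]
  | tmul a s => simp [← mul_assoc]

theorem Sinv_zigzag (X Y Z : H) : A.Sinv (A.zigzag (X ⊗ₜ (Y ⊗ₜ Z))) =
    A.contractα (Y ⊗ₜ Z) * A.Sinv A.β * A.Sinv X := by
  simp [Sinv_mul, mul_assoc]

/-- The counterpart of `α_mul_pR_of_intertwiner` for `V`: contraction with `β` is undone by
`q_R`. -/
theorem qR_mul_β_of_intertwiner {M : Type*} [AddCommGroup M] [Module k M]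
    {Γ : H ⊗[k] H →ₗ[k] M} (hΓ : ∀ a b, Γ (a ⊗ₜ b) = Γ (1 ⊗ₜ (b * A.Sinv a))) :
    Γ (A.qR * ((1 : H) ⊗ₜ[k] A.Sinv A.β)) = Γ 1 := by
  have : ∀ t, Γ (TensorProduct.map LinearMap.id A.contractα t * ((1 : H) ⊗ₜ[k] A.Sinv A.β)) =
      Γ (1 ⊗ₜ A.Sinv (A.zigzag t)) := by
    intro t
    induction t using tensor₃_induction with
    | add s t hs ht => simp only [map_add, add_mul, TensorProduct.tmul_add, hs, ht]
    | tmul a b c => simp [hΓ a, Sinv_mul, mul_assoc]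
  rw [qR, this, zigzag_φ, Sinv_one, Algebra.TensorProduct.one_def]

/-- The mirror image of `eq_zero_of_mul_α₃`. -/
theorem eq_zero_of_β_mul₃ {G : H ⊗[k] (H ⊗[k] H)}
    (hG : ∀ a, ((1 : H) ⊗ₜ[k] ((1 : H) ⊗ₜ[k] A.Sinv a)) * G =
      A.actSinv₃ G (A.comul₁ (appendOne k H (A.comul a))))
    (h : ((1 : H) ⊗ₜ[k] ((1 : H) ⊗ₜ[k] A.Sinv A.β)) * G = 0) : G = 0 := by
  have h0 : ∀ b : H, A.comul₁ (A.comulFst ((1 : H) ⊗ₜ[k] b)) =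
      (1 : H) ⊗ₜ ((1 : H) ⊗ₜ ((1 : H) ⊗ₜ b)) := by
    intro b
    rw [comulFst_tmul, map_one, join_one, comul₁_tmul, map_one, Algebra.TensorProduct.one_def,
      join₂_tmul]
  have h1 : ∀ a : H, A.comulFst (a ⊗ₜ[k] (1 : H)) = appendOne k H (A.comul a) := fun a => rfl
  have := A.qR_mul_β_of_intertwiner
    (Γ := A.actSinv₃ G ∘ₗ (A.comul₁.comp A.comulFst).toLinearMap) (by
      intro a b
      have h2 : a ⊗ₜ[k] b = (1 ⊗ₜ b) * (a ⊗ₜ 1) := by simp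
      simp only [LinearMap.comp_apply, AlgHom.toLinearMap_apply, AlgHom.comp_apply]
      rw [h2, map_mul A.comulFst, map_mul A.comul₁, actSinv₃_mul, h1, ← hG, h0, h0]
      simp [← mul_assoc])
  simp only [LinearMap.comp_apply, AlgHom.toLinearMap_apply, AlgHom.comp_apply, map_one,
    actSinv₃_one, map_mul, actSinv₃_mul, h0] at this
  rw [← this]
  have h3 : A.actSinv₃ G ((1 : H) ⊗ₜ ((1 : H) ⊗ₜ ((1 : H) ⊗ₜ A.Sinv A.β))) = 0 := by
    rw [actSinv₃_tmul, Sinv_one, map_one, map_one, mul_one, h]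
  rw [h3, actSinv₃, LinearMap.comp_apply, sandwich_zero_mid]

/-- `(1 ⊗ V) (id ⊗ Δ)(V) φ = ∑ (y ⊗ z ⊗ 1) (Δ ⊗ id)(V Δ(S⁻¹(x)))`. -/
theorem comulSnd_V_mul_φ :
    ((1 : H) ⊗ₜ[k] A.V) * (A.comulSnd A.V * A.φ) =
      A.actSinv₃ (A.comulFst A.V) (appendOne₃ k H A.φinv) := by
  set u := A.V with hu
  set G := ((1 : H) ⊗ₜ[k] u) * (A.comulSnd u * A.φ) with hG
  have hum : ∀ a, ((1 : H) ⊗ₜ[k] A.Sinv a) * u = A.actSinv u (appendOne k H (A.comul a)) :=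
    A.mul_V
  have hR : ∀ a : H, ∀ s : H ⊗[k] H, ((1 : H) ⊗ₜ[k] (s * A.comul (A.Sinv a))) * A.comulSnd u =
      ((1 : H) ⊗ₜ[k] s) * A.comulSnd (A.actSinv u (appendOne k H (A.comul a))) := by
    intro a s
    rw [← hum, map_mul, ← mul_assoc]
    simp
  rw [← sub_eq_zero]
  apply A.eq_zero_of_β_mul₃
  · intro a
    have e1 : ∀ t, ((1 : H) ⊗ₜ[k] A.actSinv u (appendOne k H t)) * (A.comulSnd u * A.φ) =
        A.actSinv₃ G (A.comul₁ (appendOne k H t)) := by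
      intro t
      induction t with
      | zero => simp
      | add s t hs ht => simp only [map_add, TensorProduct.tmul_add, add_mul, hs, ht]
      | tmul a b =>
        have e2 : ∀ t, ((1 : H) ⊗ₜ[k] ((b ⊗ₜ 1) * u)) *
            (A.comulSnd (A.actSinv u (appendOne k H t)) * A.φ) =
            A.actSinv₃ G (join₂ k H t (b ⊗ₜ 1)) := by
          intro t
          induction t with
          | zero => simp
          | add s t hs ht => simp only [map_add, add_mul, mul_add, join₂_add, hs, ht]
          | tmul p q =>
            rw [appendOne_tmul, actSinv_tmul, ← mul_assoc (q ⊗ₜ[k] (1 : H)), map_mul,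
              mul_assoc (A.comulSnd _),
              comulSnd_comul_mul_φ, join₂_tmul, actSinv₃_tmul, map_mul, hG]
            simp only [← mul_assoc]
            simp
        rw [appendOne_tmul, actSinv_tmul, ← mul_assoc, ← mul_assoc (b ⊗ₜ[k] (1 : H)), hR,
          mul_assoc, e2, comul₁_tmul]
    have e3 : ((1 : H) ⊗ₜ[k] ((1 : H) ⊗ₜ[k] A.Sinv a)) * G =
        A.actSinv₃ G (A.comul₁ (appendOne k H (A.comul a))) := by
      rw [← e1, ← hum, hG, ← mul_assoc]
      simp
    have e4 : ((1 : H) ⊗ₜ[k] ((1 : H) ⊗ₜ[k] A.Sinv a)) *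
        A.actSinv₃ (A.comulFst u) (appendOne₃ k H A.φinv) =
        A.actSinv₃ (A.actSinv₃ (A.comulFst u) (appendOne₃ k H A.φinv))
          (A.comul₁ (appendOne k H (A.comul a))) := by
      have e5 : ((1 : H) ⊗ₜ[k] ((1 : H) ⊗ₜ[k] A.Sinv a)) * A.comulFst u =
          A.comulFst (((1 : H) ⊗ₜ[k] A.Sinv a) * u) := by
        rw [map_mul, comulFst_tmul, map_one, join_one]
      rw [mul_actSinv₃_appendOne₃, e5, hum, comulFst_actSinv, ← actSinv₃_mul, comul₂_appendOne,
        ← map_mul, φinv_mul_comulSnd_comul, map_mul, actSinv₃_mul, appendOne₃_comulFst]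
    rw [mul_sub, e3, e4, actSinv₃_sub]
  · have e1 : ∀ s, ((1 : H) ⊗ₜ[k] A.actSinv (A.comul (A.Sinv A.β)) s) * (A.comulSnd u * A.φ) =
        A.actSinv₃ (A.comulFst (A.comul (A.Sinv A.β)))
          (A.comul₁ s * (A.comul₃ A.φinv * ((1 : H) ⊗ₜ[k] A.φ))) := by
      intro s
      induction s with
      | zero => simp
      | add s t hs ht => simp only [map_add, TensorProduct.tmul_add, add_mul, hs, ht]
      | tmul a v =>
        have e2 : ((1 : H) ⊗ₜ[k] (v * A.comul (A.Sinv A.β))) *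
            A.comulSnd (A.actSinv u (appendOne k H (A.comul a))) =
            ((1 : H) ⊗ₜ[k] v) *
            A.comulSnd (A.actSinv (A.comul (A.Sinv A.β))
              (appendOne k H (A.comul a) * A.φinv)) := by
          rw [actSinv_mul, ← evalV, ← β_mul_V, ← mul_actSinv_appendOne, map_mul, ← mul_assoc]
          simp [hu]
        rw [actSinv_tmul, ← mul_assoc, ← mul_assoc v, hR, e2, mul_assoc, comulSnd_actSinv_mul_φ,
          ← actSinv₃_mul_left, map_mul A.comul₃, ← mul_assoc, ← mul_assoc, mul_comul₃_appendOne,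
          comul₁_tmul, mul_assoc]
    have e3 : ((1 : H) ⊗ₜ[k] ((1 : H) ⊗ₜ[k] A.Sinv A.β)) * G =
        A.actSinv₃ (A.comulFst (A.comul (A.Sinv A.β)))
          (appendOne₃ k H A.φinv * A.comul₂ A.φinv) := by
      rw [← comul₁_mul_comul₃_φinv_mul, ← e1, ← evalV, ← β_mul_V, hG, ← mul_assoc]
      simp [hu]
    have e4 : ((1 : H) ⊗ₜ[k] ((1 : H) ⊗ₜ[k] A.Sinv A.β)) *
        A.actSinv₃ (A.comulFst u) (appendOne₃ k H A.φinv) =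
        A.actSinv₃ (A.comulFst (A.comul (A.Sinv A.β)))
          (appendOne₃ k H A.φinv * A.comul₂ A.φinv) := by
      have e5 : ((1 : H) ⊗ₜ[k] ((1 : H) ⊗ₜ[k] A.Sinv A.β)) * A.comulFst u =
          A.comulFst (((1 : H) ⊗ₜ[k] A.Sinv A.β) * u) := by
        rw [map_mul, comulFst_tmul, map_one, join_one]
      rw [mul_actSinv₃_appendOne₃, e5, β_mul_V, evalV, comulFst_actSinv, ← actSinv₃_mul]
    rw [mul_sub, e3, e4, sub_self]

/-! ### Counits of `U` and `V` -/

/-- `(ε ⊗ id)(U) = 1`, which is the antipode identity `∑ S(x) α y β S(z) = 1` for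
`φ⁻¹ = ∑ x ⊗ y ⊗ z`. -/
theorem counitFst_twistFreeU : A.counitFst A.twistFreeU = 1 := by
  rw [twistFreeU_eq, ← A.zigzagInv_φinv]
  generalize A.φinv = t
  induction t using tensor₃_induction with
  | add s t hs ht => simp only [map_add, hs, ht]
  | tmul x y z => simp [counitFst_pR]

theorem counitFst_V : A.counitFst A.V = 1 := by
  set v := A.counitFst A.V with hv
  -- The identities for `V` say that `v` is central and that `S⁻¹(β) v = S⁻¹(β)`.
  have h1 : ∀ a, A.Sinv a * v = v * A.Sinv a := by
    intro a
    have h := congrArg A.counitFst (A.mul_V a)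
    have h2 : ∀ t, A.counitFst (A.actSinv A.V (join k H t 1)) = v * A.Sinv (A.counitSnd t) := by
      intro t
      induction t with
      | zero => simp
      | add s t hs ht => simp only [map_add, join_add, mul_add, hs, ht]
      | tmul a b => simp [← hv]
    rw [h2, map_mul] at h
    simpa [← hv] using h
  have h2 : A.Sinv A.β * v = A.Sinv A.β := by
    have h := congrArg A.counitFst A.β_mul_V
    have h4 : ∀ t, A.counitFst (A.actSinv (A.comul (A.Sinv A.β)) t) =
        (LinearMap.mul' k H ∘ₗ (TensorProduct.comm k H H).toLinearMap ∘ₗ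
          TensorProduct.map (LinearMap.mulLeft k (A.Sinv A.β) ∘ₗ A.Sinv) LinearMap.id)
          (A.counit₂ t) := by
      intro t
      induction t using tensor₃_induction with
      | add s t hs ht => simp only [map_add, hs, ht]
      | tmul x y z => simp
    rw [evalV, h4, counit₂_φinv, map_mul, Algebra.TensorProduct.one_def] at h
    simpa [← hv] using h
  have h3 : ∀ t, A.Sinv (A.zigzag t) * v = A.Sinv (A.zigzag t) := by
    intro t
    induction t using tensor₃_induction with
    | add s t hs ht => simp only [map_add, add_mul, hs, ht]
    | tmul x y z => rw [Sinv_zigzag, mul_assoc, h1, ← mul_assoc, mul_assoc (A.contractα _), h2]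
  have := h3 A.φ
  rwa [zigzag_φ, Sinv_one, one_mul] at this

/-! ### Quasi-Hopf bimodules -/

section TensorActions

variable {M N : Type*} [AddCommGroup M] [Module k M] [Ring N] [Algebra k N]

variable (N) in
/-- The action `(a ⊗ s)(m ⊗ t) = a m ⊗ s t` of `H ⊗ N` on `M ⊗ N`, for a family of
endomorphisms of `M` indexed by `H`. -/
def tensorLeft (l : H →ₗ[k] Module.End k M) : H ⊗[k] N →ₗ[k] Module.End k (M ⊗[k] N) :=
  TensorProduct.homTensorHomMap (RingHom.id k) M N M N ∘ₗ TensorProduct.map l (LinearMap.mul k N)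

variable (N) in
/-- The action `(m ⊗ t)(a ⊗ s) = m a ⊗ t s` of `H ⊗ N` on `M ⊗ N`, for a family of
endomorphisms of `M` indexed by `H`. -/
def tensorRight (r : H →ₗ[k] Module.End k M) : H ⊗[k] N →ₗ[k] Module.End k (M ⊗[k] N) :=
  TensorProduct.homTensorHomMap (RingHom.id k) M N M N ∘ₗ
    TensorProduct.map r (LinearMap.mul k N).flip

@[simp] theorem tensorLeft_tmul (l : H →ₗ[k] Module.End k M) (a : H) (s : N) (m : M) (t : N) :
    tensorLeft N l (a ⊗ₜ s) (m ⊗ₜ t) = l a m ⊗ₜ (s * t) := by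
  simp [tensorLeft]

@[simp] theorem tensorRight_tmul (r : H →ₗ[k] Module.End k M) (a : H) (s : N) (m : M) (t : N) :
    tensorRight N r (a ⊗ₜ s) (m ⊗ₜ t) = r a m ⊗ₜ (t * s) := by
  simp [tensorRight]

end TensorActions

/-- A right quasi-Hopf bimodule over `H`: an `H`-bimodule `M` with a bimodule coaction
`ρ : M → M ⊗ H` that is counital and coassociative up to conjugation by `φ`. -/
structure Bimodule (M : Type*) [AddCommGroup M] [Module k M] where
  /-- the left action -/
  left : H →ₗ[k] Module.End k M
  /-- the right action -/
  right : H →ₗ[k] Module.End k M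
  left_mul : ∀ a b m, left (a * b) m = left a (left b m)
  left_one : ∀ m, left 1 m = m
  right_mul : ∀ a b m, right (a * b) m = right b (right a m)
  right_one : ∀ m, right 1 m = m
  left_right : ∀ a b m, left a (right b m) = right b (left a m)
  /-- the coaction -/
  coact : M →ₗ[k] M ⊗[k] H
  coact_left : ∀ a m, coact (left a m) = tensorLeft H left (A.comul a) (coact m)
  coact_right : ∀ a m, coact (right a m) = tensorRight H right (A.comul a) (coact m)
  counit_coact : ∀ m,
    TensorProduct.rid k M (TensorProduct.map LinearMap.id A.counit.toLinearMap (coact m)) = m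
  coassoc : ∀ m, tensorLeft (H ⊗[k] H) left A.φ
      (TensorProduct.assoc k M H H (TensorProduct.map coact LinearMap.id (coact m))) =
    tensorRight (H ⊗[k] H) right A.φ
      (TensorProduct.map LinearMap.id A.comul.toLinearMap (coact m))

namespace Bimodule

variable {A} {M : Type*} [AddCommGroup M] [Module k M] (B : A.Bimodule M)

theorem tensorLeft_mul {N : Type*} [Ring N] [Algebra k N] (s t : H ⊗[k] N) (w : M ⊗[k] N) :
    tensorLeft N B.left (s * t) w = tensorLeft N B.left s (tensorLeft N B.left t w) := by
  induction w with
  | zero => simp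
  | add w w' h h' => simp only [map_add, h, h']
  | tmul m n =>
    induction t with
    | zero => simp
    | add t t' h h' => simp only [map_add, mul_add, LinearMap.add_apply, h, h']
    | tmul a b =>
      induction s with
      | zero => simp
      | add t t' h h' => simp only [map_add, add_mul, LinearMap.add_apply, h, h']
      | tmul c d => simp [left_mul, mul_assoc]

theorem tensorLeft_one {N : Type*} [Ring N] [Algebra k N] (w : M ⊗[k] N) :
    tensorLeft N B.left 1 w = w := by
  rw [Algebra.TensorProduct.one_def]
  induction w with
  | zero => simp
  | add w w' h h' => simp only [map_add, h, h']
  | tmul m n => simp [left_one]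

/-- The double coaction, solved for with quasi-coassociativity. -/
theorem coact_coact (m : M) :
    TensorProduct.assoc k M H H (TensorProduct.map B.coact LinearMap.id (B.coact m)) =
      tensorLeft (H ⊗[k] H) B.left A.φinv (tensorRight (H ⊗[k] H) B.right A.φ
        (TensorProduct.map LinearMap.id A.comul.toLinearMap (B.coact m))) := by
  rw [← B.coassoc, ← B.tensorLeft_mul, φinv_mul_φ, B.tensorLeft_one]

/-- The right action as a map `m ⊗ x ↦ m x`. -/
def rightMap : M ⊗[k] H →ₗ[k] M := TensorProduct.lift B.right.flip

@[simp] theorem rightMap_tmul (m : M) (x : H) : B.rightMap (m ⊗ₜ x) = B.right x m := by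
  simp [rightMap]

/-- The map `(a ⊗ b) ⊗ (m ⊗ x) ↦ a · m · β S(b x)`. -/
def projAux : H ⊗[k] H →ₗ[k] M ⊗[k] H →ₗ[k] M :=
  TensorProduct.curry (B.rightMap ∘ₗ
    TensorProduct.map (TensorProduct.lift B.left)
      (LinearMap.mulLeft k A.β ∘ₗ A.S ∘ₗ LinearMap.mul' k H) ∘ₗ
    (TensorProduct.tensorTensorTensorComm k H H M H).toLinearMap)

@[simp] theorem projAux_tmul (a b : H) (m : M) (x : H) :
    B.projAux (a ⊗ₜ b) (m ⊗ₜ x) = B.right (A.β * A.S (b * x)) (B.left a m) := by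
  simp [projAux]

/-- The projection `E(m) = q¹ · m₀ · β S(q² m₁)` onto the coinvariants, where
`q_R = q¹ ⊗ q²`. -/
def proj : M →ₗ[k] M := B.projAux A.qR ∘ₗ B.coact

theorem proj_apply (m : M) : B.proj m = B.projAux A.qR (B.coact m) := rfl

/-- Every element of a quasi-Hopf bimodule is recovered from the coinvariants:
`m = E(m₀) · m₁`. -/
theorem rightMap_proj_coact (m : M) :
    B.rightMap (TensorProduct.map B.proj LinearMap.id (B.coact m)) = m := by
  -- `E(m₀) · m₁` is a contraction `K` of the double coaction.  Quasi-coassociativity turns the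
  -- latter into a coproduct, up to `φ⁻¹` on the left, which cancels the `φ` in `q_R`, and `φ` on
  -- the right, which contracts to `∑ X β S(Y) α Z = 1`.
  let K : H ⊗[k] H → M ⊗[k] (H ⊗[k] H) →ₗ[k] M := fun t =>
    B.rightMap ∘ₗ TensorProduct.map (B.projAux t) LinearMap.id ∘ₗ
      (TensorProduct.assoc k M H H).symm.toLinearMap
  have hK : ∀ t n b c, K t (n ⊗ₜ (b ⊗ₜ c)) = B.right c (B.projAux t (n ⊗ₜ b)) := by
    intro t n b c; simp [K]
  let K₁ : M ⊗[k] (H ⊗[k] H) →ₗ[k] M :=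
    B.rightMap ∘ₗ TensorProduct.map LinearMap.id (LinearMap.mulLeft k A.β ∘ₗ A.evalα)
  have h1 : ∀ w, B.rightMap (TensorProduct.map B.proj LinearMap.id w) =
      K A.qR (TensorProduct.assoc k M H H (TensorProduct.map B.coact LinearMap.id w)) := by
    intro w
    induction w with
    | zero => simp
    | add w w' h h' => simp only [map_add, h, h']
    | tmul n x => simp [K, proj_apply]
  have hKadd : ∀ s t w, K (s + t) w = K s w + K t w := by
    intro s t w
    induction w using TensorProduct.induction_on with
    | zero => simp
    | add w w' h h' => simp only [map_add, h, h']; abel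
    | tmul n v =>
      induction v with
      | zero => simp
      | add w w' h h' => simp only [map_add, TensorProduct.tmul_add, h, h']; abel
      | tmul b c => simp [hK]
  have h2 : ∀ s t w, K (TensorProduct.map LinearMap.id A.contractα s)
      (tensorLeft (H ⊗[k] H) B.left t w) = K₁ (tensorLeft (H ⊗[k] H) B.left (s * t) w) := by
    intro s t w
    induction w with
    | zero => simp
    | add w w' h h' => simp only [map_add, h, h']
    | tmul n v =>
      induction v with
      | zero => simp
      | add w w' h h' => simp only [map_add, TensorProduct.tmul_add, h, h']
      | tmul b c =>
        induction s using tensor₃_induction with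
        | add s s' h h' => simp only [map_add, hKadd, add_mul, LinearMap.add_apply, h, h']
        | tmul X Y Z =>
          induction t using tensor₃_induction with
          | add s s' h h' => simp only [map_add, mul_add, LinearMap.add_apply, h, h']
          | tmul x y z =>
            simp [hK, K₁, ← B.right_mul, S_mul, mul_assoc, B.left_mul]
  have h3 : ∀ s w, K₁ (tensorRight (H ⊗[k] H) B.right s
      (TensorProduct.map LinearMap.id A.comul.toLinearMap w)) =
      B.right (A.zigzag s)
        (TensorProduct.rid k M (TensorProduct.map LinearMap.id A.counit.toLinearMap w)) := by
    intro s w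
    induction w with
    | zero => simp
    | add w w' h h' => simp only [map_add, h, h']
    | tmul n x =>
      induction s with
      | zero => simp
      | add s s' h h' => simp only [map_add, LinearMap.add_apply, h, h']
      | tmul X u => simp [K₁, evalα_comul_mul, ← B.right_mul]
  rw [h1, coact_coact, qR, h2, φ_mul_φinv, tensorLeft_one, h3, zigzag_φ, B.right_one,
    B.counit_coact]

/-- `E(m · a) = ε(a) E(m)`: the coproduct of `a` is absorbed by `β`. -/
theorem proj_right (a : H) (m : M) : B.proj (B.right a m) = A.counit a • B.proj m := by
  have h : ∀ (t s : H ⊗[k] H) (w : M ⊗[k] H), A.contractβ s = A.counit a • A.β →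
      B.projAux t (tensorRight H B.right s w) = A.counit a • B.projAux t w := by
    intro t s w hs
    induction w with
    | zero => simp
    | add w w' h h' => simp only [map_add, smul_add, h, h']
    | tmul n x =>
      induction t with
      | zero => simp
      | add t t' h h' => simp only [map_add, LinearMap.add_apply, smul_add, h, h']
      | tmul p q =>
        have : ∀ s, B.projAux (p ⊗ₜ q) (tensorRight H B.right s (n ⊗ₜ x)) =
            B.right (A.contractβ s * A.S (q * x)) (B.left p n) := by
          intro s
          induction s with
          | zero => simp
          | add t t' h h' => simp only [map_add, LinearMap.add_apply, add_mul, h, h']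
          | tmul c d => simp [B.left_right, ← B.right_mul, S_mul, mul_assoc]
        rw [this, hs]
        simp
  rw [proj_apply, coact_right, h _ _ _ (A.contractβ_comul a)]
  rfl

/-- `E(m₀) ⊗ m₁`. -/
def projCoact : M →ₗ[k] M ⊗[k] H := TensorProduct.map B.proj LinearMap.id ∘ₗ B.coact

/-- `m ↦ E(m₀) ⊗ m₁` is right `H`-linear for the action on the second factor. -/
theorem projCoact_right (a : H) (m : M) : B.projCoact (B.right a m) =
    TensorProduct.map LinearMap.id (LinearMap.mulRight k a) (B.projCoact m) := by
  have h : ∀ s w, TensorProduct.map B.proj LinearMap.id (tensorRight H B.right s w) =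
      TensorProduct.map LinearMap.id (LinearMap.mulRight k (A.counitFst s))
        (TensorProduct.map B.proj LinearMap.id w) := by
    intro s w
    induction w with
    | zero => simp
    | add w w' h h' => simp only [map_add, h, h']
    | tmul n x =>
      induction s with
      | zero => simp
      | add s s' h h' =>
        simp only [map_add, LinearMap.add_apply, h, h', TensorProduct.map_tmul,
          LinearMap.mulRight_apply, mul_add, TensorProduct.tmul_add]
      | tmul c d => simp [proj_right, TensorProduct.smul_tmul']
  rw [projCoact, LinearMap.comp_apply, LinearMap.comp_apply, coact_right, h, counitFst_comul]

/-- The image of `E` consists of coinvariants: `E(n₀) ⊗ n₁ = n ⊗ 1` for `n = E(m)`. -/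
theorem projCoact_proj (m : M) : B.projCoact (B.proj m) = B.proj m ⊗ₜ 1 := by
  -- For `t = t¹ ⊗ t²` and `v = v¹ ⊗ v²`, the map `L t` sends `n ⊗ v` to the image under `E ⊗ id` of
  -- the product of `Δ(t¹) (1 ⊗ v¹ β S(v²)) (1 ⊗ S(t²))` and `n ⊗ 1`.  It computes `E(n₀) ⊗ n₁` from
  -- the double coaction of `m`; `φ` acting on the right disappears because its first factor is
  -- absorbed by `E`, and `φ⁻¹` on the left combines with `Δ` and `β` to `p_R`.
  let L : H ⊗[k] H → M ⊗[k] (H ⊗[k] H) →ₗ[k] M ⊗[k] H := fun t =>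
    TensorProduct.lift (LinearMap.mk₂ k (fun n v => TensorProduct.map B.proj LinearMap.id
      (tensorLeft H B.left (sandwich A.comul.toLinearMap ((1 : H) ⊗ₜ A.contractβ v) A.inrS t)
        (n ⊗ₜ 1)))
      (by intro n n' v; simp [TensorProduct.add_tmul])
      (by intro c n v; simp [← TensorProduct.smul_tmul'])
      (by intro n v v'; simp [TensorProduct.tmul_add, sandwich_add_mid])
      (by intro c n v; simp [sandwich_smul_mid]))
  have hL : ∀ t n v, L t (n ⊗ₜ v) = TensorProduct.map B.proj LinearMap.id
      (tensorLeft H B.left (sandwich A.comul.toLinearMap ((1 : H) ⊗ₜ A.contractβ v) A.inrS t)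
        (n ⊗ₜ 1)) := by
    intro t n v; simp [L]
  let L' : H ⊗[k] H → H → M ⊗[k] (H ⊗[k] H) →ₗ[k] M ⊗[k] H := fun s b =>
    TensorProduct.lift (LinearMap.mk₂ k (fun n v => TensorProduct.map B.proj LinearMap.id
      (tensorLeft H B.left (s * (((1 : H) ⊗ₜ A.contractβ v) * ((1 : H) ⊗ₜ A.S b))) (n ⊗ₜ 1)))
      (by intro n n' v; simp [TensorProduct.add_tmul])
      (by intro c n v; simp [← TensorProduct.smul_tmul'])
      (by intro n v v'; simp only [TensorProduct.tmul_add, add_mul, mul_add, map_add,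
            LinearMap.add_apply])
      (by intro c n v; simp))
  have hL' : ∀ s b n v, L' s b (n ⊗ₜ v) = TensorProduct.map B.proj LinearMap.id
      (tensorLeft H B.left (s * (((1 : H) ⊗ₜ A.contractβ v) * ((1 : H) ⊗ₜ A.S b)))
        (n ⊗ₜ 1)) := by
    intro s b n v; simp [L']
  have hLL' : ∀ a b w, L (a ⊗ₜ b) w = L' (A.comul a) b w := by
    intro a b w
    induction w with
    | zero => simp
    | add w w' h h' => simp only [map_add, h, h']
    | tmul n v => rw [hL, hL', sandwich_tmul]; simp
  have hLadd : ∀ s t w, L (s + t) w = L s w + L t w := by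
    intro s t w
    induction w with
    | zero => simp
    | add w w' h h' => simp only [map_add, h, h']; abel
    | tmul n v => simp [hL]
  have hL0 : ∀ w, L 0 w = 0 := by
    intro w
    have := hLadd 0 0 w
    simpa using this
  have h1 : ∀ t w, B.projCoact (B.projAux t w) =
      L t (TensorProduct.assoc k M H H (TensorProduct.map B.coact LinearMap.id w)) := by
    intro t w
    induction w with
    | zero => simp
    | add w w' h h' => simp only [map_add, h, h']
    | tmul n x =>
      induction t with
      | zero => simp [hL0]
      | add t t' h h' => simp only [map_add, LinearMap.add_apply, hLadd, h, h']
      | tmul a b =>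
        rw [projAux_tmul, projCoact_right, projCoact, LinearMap.comp_apply, coact_left,
          TensorProduct.map_tmul, LinearMap.id_apply]
        have h0 : ∀ y s, TensorProduct.map LinearMap.id (LinearMap.mulRight k (A.β * A.S (b * x)))
            (TensorProduct.map B.proj LinearMap.id (tensorLeft H B.left s y)) =
            L' s b (TensorProduct.assoc k M H H (y ⊗ₜ x)) := by
          intro y s
          induction y with
          | zero => simp
          | add y y' h h' => simp only [map_add, TensorProduct.add_tmul, h, h']
          | tmul n' c =>
            induction s with
            | zero => simp [hL']
            | add s s' h h' =>
              simp only [map_add, LinearMap.add_apply, TensorProduct.assoc_tmul, hL',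
                add_mul] at h h' ⊢
              rw [h, h']
            | tmul p q => simp [hL', S_mul, mul_assoc]
        rw [h0, hLL']
  have h2 : ∀ t t' s w, L t (tensorLeft (H ⊗[k] H) B.left t'
      (tensorRight (H ⊗[k] H) B.right s w)) =
      L t (tensorLeft (H ⊗[k] H) B.left t'
        (TensorProduct.map LinearMap.id (LinearMap.mulRight k (A.counit₁ s)) w)) := by
    intro t t' s w
    induction w with
    | zero => simp
    | add w w' h h' => simp only [map_add, h, h']
    | tmul n v =>
      induction t' with
      | zero => simp
      | add t₁ t₂ h h' => simp only [map_add, LinearMap.add_apply, h, h']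
      | tmul x r =>
        induction s with
        | zero => simp
        | add s s' h h' =>
          simp only [map_add, LinearMap.add_apply, TensorProduct.map_tmul,
            LinearMap.mulRight_apply, mul_add, TensorProduct.tmul_add] at h h' ⊢
          rw [h, h']
        | tmul X u =>
          have h : ∀ s : H ⊗[k] H, TensorProduct.map B.proj LinearMap.id
              (tensorLeft H B.left s (B.left x (B.right X n) ⊗ₜ 1)) =
              A.counit X • TensorProduct.map B.proj LinearMap.id
                (tensorLeft H B.left s (B.left x n ⊗ₜ 1)) := by
            intro s
            induction s with
            | zero => simp
            | add s s' h h' => simp only [map_add, LinearMap.add_apply, smul_add, h, h']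
            | tmul p q => simp [left_right, proj_right, ← TensorProduct.smul_tmul']
          simp only [tensorRight_tmul, tensorLeft_tmul, hL, h, counit₁_tmul,
            TensorProduct.map_tmul, LinearMap.mulRight_apply, LinearMap.id_apply, mul_smul_comm,
            map_smul, TensorProduct.tmul_smul]
  have h3 : ∀ t t' w, L t (tensorLeft (H ⊗[k] H) B.left t'
      (TensorProduct.map LinearMap.id A.comul.toLinearMap w)) =
      TensorProduct.map B.proj LinearMap.id (tensorLeft H B.left
        (sandwich A.comul.toLinearMap (TensorProduct.map LinearMap.id A.contractβ t') A.inrS t)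
        ((TensorProduct.rid k M (TensorProduct.map LinearMap.id A.counit.toLinearMap w))
          ⊗ₜ 1)) := by
    intro t t' w
    induction w with
    | zero => simp
    | add w w' h h' => simp only [map_add, TensorProduct.add_tmul, h, h']
    | tmul n x =>
      induction t' with
      | zero => simp [sandwich_zero_mid]
      | add t₁ t₂ h h' => simp only [map_add, LinearMap.add_apply, sandwich_add_mid, h, h']
      | tmul y r =>
        have h : ∀ c, sandwich A.comul.toLinearMap ((1 : H) ⊗ₜ c) A.inrS t * (y ⊗ₜ[k] (1 : H)) =
            sandwich A.comul.toLinearMap (y ⊗ₜ c) A.inrS t := by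
          intro c
          induction t with
          | zero => simp
          | add s s' h h' => simp only [map_add, add_mul, h, h']
          | tmul p q => simp [mul_assoc]
        have h' : B.left y n ⊗ₜ[k] (1 : H) = tensorLeft H B.left (y ⊗ₜ 1) (n ⊗ₜ 1) := by simp
        simp only [TensorProduct.map_tmul, LinearMap.id_apply, AlgHom.toLinearMap_apply,
          tensorLeft_tmul, hL, contractβ_mul_comul, TensorProduct.tmul_smul, sandwich_smul_mid,
          map_smul, LinearMap.smul_apply, TensorProduct.rid_tmul, ← TensorProduct.smul_tmul']
        rw [h', ← tensorLeft_mul, h]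
  have h4 : ∀ w : M ⊗[k] (H ⊗[k] H), TensorProduct.map LinearMap.id
      (LinearMap.mulRight k (1 : H ⊗[k] H)) w = w := by
    intro w
    simp
  conv_lhs => rw [proj_apply, h1, coact_coact, h2, counit₁_φ, h4, h3, ← pR, sandwich_pR_qR,
    tensorLeft_one, B.counit_coact, TensorProduct.map_tmul, LinearMap.id_apply]

end Bimodule

/-! ### The dual of `H` as a quasi-Hopf bimodule -/

@[simp] theorem sliceRight_tmul (ψ : Module.Dual k H) (a b : H) :
    sliceRight ψ (a ⊗ₜ[k] b) = ψ b • a := by simp [sliceRight]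

@[simp] theorem sliceLeft_tmul (ψ : Module.Dual k H) (a b : H) :
    sliceLeft ψ (a ⊗ₜ[k] b) = ψ a • b := by simp [sliceLeft]

theorem comulBar_apply (m : H) : A.comulBar m = A.V * (A.comul m * A.U) := by
  simp [comulBar]

/-- `(1 ⊗ S⁻¹(a)) Δ̄(m) = ∑ (a₂ ⊗ 1) Δ̄(S⁻¹(a₁) m)`, with the right side written through `V`
and `U`. -/
theorem mul_comulBar (a m : H) : ((1 : H) ⊗ₜ[k] A.Sinv a) * A.comulBar m =
    A.actSinv A.V (appendOne k H (A.comul a)) * (A.comul m * A.U) := by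
  rw [comulBar_apply, ← mul_assoc, mul_V]
  rfl

theorem counitFst_comulBar [FiniteDimensional k H] (m : H) : A.counitFst (A.comulBar m) = m := by
  rw [comulBar_apply, map_mul, map_mul, counitFst_V, U_eq, counitFst_twistFreeU, counitFst_comul,
    one_mul, mul_one]

/-- `Δ̄(m) (1 ⊗ S(a)) = ∑ Δ̄(m S(a₁)) (a₂ ⊗ 1)`, with the right side written through `V` and `U`. -/
theorem comulBar_mul [FiniteDimensional k H] (m a : H) :
    A.comulBar m * ((1 : H) ⊗ₜ[k] A.S a) =
    A.V * (A.comul m * A.actS A.U (appendOne k H (A.comul a))) := by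
  rw [comulBar_apply, mul_assoc, mul_assoc, U_eq, twistFreeU_mul]
  rfl

/-- The compatibility of `V` with `φ`, with `φ` moved to the other side:
`∑ (Y ⊗ Z ⊗ 1) (1 ⊗ V) (id ⊗ Δ)(V Δ(S⁻¹(X))) = (Δ ⊗ id)(V) φ⁻¹`, where `φ = ∑ X ⊗ Y ⊗ Z`. -/
theorem sandwich_appendOne_V : sandwich (LinearMap.id)
    (((1 : H) ⊗ₜ[k] A.V) * A.comulSnd A.V)
    (A.comulSnd.toLinearMap ∘ₗ A.comul.toLinearMap ∘ₗ A.Sinv)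
    (Algebra.TensorProduct.comm k H (H ⊗[k] (H ⊗[k] H)) (appendOne₃ k H A.φ)) =
    A.comulFst A.V * A.φinv := by
  have h1 : ((1 : H) ⊗ₜ[k] A.V) * A.comulSnd A.V =
      A.actSinv₃ (A.comulFst A.V) (appendOne₃ k H A.φinv) * A.φinv := by
    rw [← comulSnd_V_mul_φ, mul_assoc, mul_assoc, φ_mul_φinv, mul_one]
  have h2 : ∀ G s, sandwich LinearMap.id (G * A.φinv)
      (A.comulSnd.toLinearMap ∘ₗ A.comul.toLinearMap ∘ₗ A.Sinv)
      (Algebra.TensorProduct.comm k H (H ⊗[k] (H ⊗[k] H)) (appendOne₃ k H s)) =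
      A.actSinv₃ G (appendOne₃ k H s) * A.φinv := by
    intro G s
    induction s with
    | zero => simp
    | add s s' h h' => simp only [map_add, add_mul, h, h']
    | tmul a s => simp [mul_assoc, φinv_mul_comulSnd_comul]
  rw [h1, h2, ← actSinv₃_mul, ← map_mul, φ_mul_φinv, map_one, actSinv₃_one]

section Slice

variable (ψ : Module.Dual k H)

theorem sliceRight_inl_mul (b : H) (t : H ⊗[k] H) :
    sliceRight ψ ((b ⊗ₜ 1) * t) = b * sliceRight ψ t := by
  induction t with
  | zero => simp
  | add s t hs ht => simp only [map_add, mul_add, hs, ht]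
  | tmul c d => simp

theorem sliceRight_mul_inl (b : H) (t : H ⊗[k] H) :
    sliceRight ψ (t * (b ⊗ₜ 1)) = sliceRight ψ t * b := by
  induction t with
  | zero => simp
  | add s t hs ht => simp only [map_add, add_mul, hs, ht]
  | tmul c d => simp

/-- `(id ⊗ id ⊗ ψ)(t)` for `t ∈ H ⊗ H ⊗ H`. -/
def sliceThird : H ⊗[k] (H ⊗[k] H) →ₗ[k] H ⊗[k] H :=
  TensorProduct.map LinearMap.id (sliceRight ψ)

theorem sliceThird_appendOne_mul (s : H ⊗[k] H) (t : H ⊗[k] (H ⊗[k] H)) :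
    sliceThird ψ (appendOne k H s * t) = s * sliceThird ψ t := by
  induction t using tensor₃_induction with
  | add s t hs ht => simp only [map_add, mul_add, hs, ht]
  | tmul a b c =>
    induction s with
    | zero => simp
    | add s t hs ht => simp only [map_add, add_mul, hs, ht]
    | tmul x y => simp [sliceThird]

theorem sliceThird_mul_appendOne (s : H ⊗[k] H) (t : H ⊗[k] (H ⊗[k] H)) :
    sliceThird ψ (t * appendOne k H s) = sliceThird ψ t * s := by
  induction t using tensor₃_induction with
  | add s t hs ht => simp only [map_add, add_mul, hs, ht]
  | tmul a b c =>
    induction s with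
    | zero => simp
    | add s t hs ht => simp only [map_add, mul_add, hs, ht]
    | tmul x y => simp [sliceThird]

theorem sliceThird_comulFst (t : H ⊗[k] H) :
    sliceThird ψ (A.comulFst t) = A.comul (sliceRight ψ t) := by
  induction t with
  | zero => simp
  | add s t hs ht => simp only [map_add, hs, ht]
  | tmul a b =>
    simp only [comulFst_tmul, sliceRight_tmul, map_smul]
    generalize A.comul a = v
    induction v with
    | zero => simp
    | add s t hs ht => simp only [map_add, join_add, smul_add, hs, ht]
    | tmul c d => simp [sliceThird]

theorem map_sliceRight_comulBar (t : H ⊗[k] H) :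
    TensorProduct.map LinearMap.id (sliceRight ψ ∘ₗ A.comulBar) t =
      sliceThird ψ (((1 : H) ⊗ₜ[k] A.V) * (A.comulSnd t * ((1 : H) ⊗ₜ[k] A.U))) := by
  induction t with
  | zero => simp
  | add s t hs ht => simp only [map_add, add_mul, mul_add, hs, ht]
  | tmul a b => simp [sliceThird, comulBar_apply]

end Slice

/-- The left action of `H` on `H^*`. -/
def dualLeftHom : H →ₗ[k] Module.End k (Module.Dual k H) where
  toFun := A.dualLeft
  map_add' a b := by ext ψ m; simp [dualLeft, Module.Dual.transpose_apply, add_mul]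
  map_smul' c a := by ext ψ m; simp [dualLeft, Module.Dual.transpose_apply]

/-- The right action of `H` on `H^*`. -/
def dualRightHom : H →ₗ[k] Module.End k (Module.Dual k H) where
  toFun := A.dualRight
  map_add' a b := by ext ψ m; simp [dualRight, Module.Dual.transpose_apply, mul_add]
  map_smul' c a := by ext ψ m; simp [dualRight, Module.Dual.transpose_apply]

@[simp] theorem dualLeftHom_apply (a : H) (ψ : Module.Dual k H) (m : H) :
    A.dualLeftHom a ψ m = ψ (A.Sinv a * m) := rfl

@[simp] theorem dualRightHom_apply (a : H) (ψ : Module.Dual k H) (m : H) :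
    A.dualRightHom a ψ m = ψ (m * A.S a) := rfl

theorem dualTensorHom_tensorLeft {N : Type*} [Ring N] [Algebra k N] (a : H) (s : N)
    (w : Module.Dual k H ⊗[k] N) (m : H) :
    dualTensorHom k H N (tensorLeft N A.dualLeftHom (a ⊗ₜ s) w) m =
      s * dualTensorHom k H N w (A.Sinv a * m) := by
  induction w with
  | zero => simp
  | add s t hs ht => simp only [map_add, LinearMap.add_apply, mul_add, hs, ht]
  | tmul χ x => simp [dualTensorHom_apply]

theorem dualTensorHom_tensorRight {N : Type*} [Ring N] [Algebra k N] (a : H) (s : N)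
    (w : Module.Dual k H ⊗[k] N) (m : H) :
    dualTensorHom k H N (tensorRight N A.dualRightHom (a ⊗ₜ s) w) m =
      dualTensorHom k H N w (m * A.S a) * s := by
  induction w with
  | zero => simp
  | add s t hs ht => simp only [map_add, LinearMap.add_apply, add_mul, hs, ht]
  | tmul χ x => simp [dualTensorHom_apply]

variable [FiniteDimensional k H]

/-- The defining property of the coaction: `ψ₀(m) ψ₁ = (id ⊗ ψ)(Δ̄(m))`. -/
theorem dualTensorHom_dualCoaction (ψ : Module.Dual k H) (m : H) :
    dualTensorHom k H H (A.dualCoaction ψ) m = sliceRight ψ (A.comulBar m) := by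
  have := (dualTensorHomEquiv k H H).apply_symm_apply (sliceRight ψ ∘ₗ A.comulBar)
  exact LinearMap.congr_fun this m

theorem dualTensorHom_injective (N : Type*) [AddCommGroup N] [Module k N] :
    Function.Injective (dualTensorHom k H N) :=
  (dualTensorHomEquiv k H N).injective

/-- The coaction of `H` on `H^*`, as a linear map. -/
def dualCoactionHom : Module.Dual k H →ₗ[k] Module.Dual k H ⊗[k] H where
  toFun := A.dualCoaction
  map_add' ψ χ := by
    apply dualTensorHom_injective
    ext m
    simp only [map_add, LinearMap.add_apply, dualTensorHom_dualCoaction]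
    generalize A.comulBar m = t
    induction t with
    | zero => simp
    | add s t hs ht => simp only [map_add, hs, ht]; abel
    | tmul a b => simp [add_smul]
  map_smul' c ψ := by
    apply dualTensorHom_injective
    ext m
    simp only [map_smul, LinearMap.smul_apply, dualTensorHom_dualCoaction, RingHom.id_apply]
    generalize A.comulBar m = t
    induction t with
    | zero => simp
    | add s t hs ht => simp only [map_add, hs, ht, smul_add]
    | tmul a b => simp [mul_smul]

@[simp] theorem dualTensorHom_dualCoactionHom (ψ : Module.Dual k H) (m : H) :
    dualTensorHom k H H (A.dualCoactionHom ψ) m = sliceRight ψ (A.comulBar m) :=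
  A.dualTensorHom_dualCoaction ψ m

theorem dualCoactionHom_left (a : H) (ψ : Module.Dual k H) :
    A.dualCoactionHom (A.dualLeftHom a ψ) =
      tensorLeft H A.dualLeftHom (A.comul a) (A.dualCoactionHom ψ) := by
  apply dualTensorHom_injective
  ext m
  rw [dualTensorHom_dualCoactionHom]
  have h1 : ∀ t, sliceRight (A.dualLeftHom a ψ) t =
      sliceRight ψ (((1 : H) ⊗ₜ[k] A.Sinv a) * t) := by
    intro t
    induction t with
    | zero => simp
    | add s t hs ht => simp only [map_add, mul_add, hs, ht]
    | tmul c d => simp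
  rw [h1, mul_comulBar]
  generalize A.comul a = t
  induction t with
  | zero => simp
  | add s t hs ht => simp only [map_add, add_mul, LinearMap.add_apply, hs, ht]
  | tmul c d =>
    rw [dualTensorHom_tensorLeft, dualTensorHom_dualCoactionHom, ← sliceRight_inl_mul,
      comulBar_apply]
    simp [mul_assoc]

theorem dualCoactionHom_right (a : H) (ψ : Module.Dual k H) :
    A.dualCoactionHom (A.dualRightHom a ψ) =
      tensorRight H A.dualRightHom (A.comul a) (A.dualCoactionHom ψ) := by
  apply dualTensorHom_injective
  ext m
  rw [dualTensorHom_dualCoactionHom]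
  have h1 : ∀ t, sliceRight (A.dualRightHom a ψ) t =
      sliceRight ψ (t * ((1 : H) ⊗ₜ[k] A.S a)) := by
    intro t
    induction t with
    | zero => simp
    | add s t hs ht => simp only [map_add, add_mul, hs, ht]
    | tmul c d => simp
  rw [h1, comulBar_mul]
  generalize A.comul a = t
  induction t with
  | zero => simp
  | add s t hs ht => simp only [map_add, mul_add, LinearMap.add_apply, hs, ht]
  | tmul c d =>
    rw [dualTensorHom_tensorRight, dualTensorHom_dualCoactionHom, ← sliceRight_mul_inl,
      comulBar_apply]
    simp [mul_assoc]

theorem rid_map_counit_dualCoactionHom (ψ : Module.Dual k H) :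
    TensorProduct.rid k (Module.Dual k H)
      (TensorProduct.map LinearMap.id A.counit.toLinearMap (A.dualCoactionHom ψ)) = ψ := by
  ext m
  have h1 : ∀ w : Module.Dual k H ⊗[k] H, TensorProduct.rid k (Module.Dual k H)
      (TensorProduct.map LinearMap.id A.counit.toLinearMap w) m =
      A.counit (dualTensorHom k H H w m) := by
    intro w
    induction w with
    | zero => simp
    | add s t hs ht => simp only [map_add, LinearMap.add_apply, hs, ht]
    | tmul χ x => simp [dualTensorHom_apply, mul_comm]
  have h2 : ∀ t, A.counit (sliceRight ψ t) = ψ (A.counitFst t) := by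
    intro t
    induction t with
    | zero => simp
    | add s t hs ht => simp only [map_add, hs, ht]
    | tmul c d => simp [mul_comm]
  rw [h1, dualTensorHom_dualCoactionHom, h2, counitFst_comulBar]

/-- The double coaction corresponds to applying `Δ̄` twice. -/
theorem dualTensorHom_coaction_coaction (w : Module.Dual k H ⊗[k] H) (m : H) :
    dualTensorHom k H (H ⊗[k] H) (TensorProduct.assoc k (Module.Dual k H) H H
      (TensorProduct.map A.dualCoactionHom LinearMap.id w)) m =
      TensorProduct.map LinearMap.id (dualTensorHom k H H w) (A.comulBar m) := by
  induction w with
  | zero => simp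
  | add s t hs ht =>
    simp only [map_add, LinearMap.add_apply, hs, ht, TensorProduct.map_add_right]
  | tmul χ x =>
    have h1 : ∀ y : Module.Dual k H ⊗[k] H, dualTensorHom k H (H ⊗[k] H)
        (TensorProduct.assoc k (Module.Dual k H) H H (y ⊗ₜ x)) m =
        dualTensorHom k H H y m ⊗ₜ x := by
      intro y
      induction y with
      | zero => simp
      | add s t hs ht => simp only [map_add, LinearMap.add_apply, TensorProduct.add_tmul, hs, ht]
      | tmul χ' c => simp [dualTensorHom_apply, TensorProduct.smul_tmul']
    rw [TensorProduct.map_tmul, LinearMap.id_apply, h1, dualTensorHom_dualCoactionHom]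
    generalize A.comulBar m = t
    induction t with
    | zero => simp
    | add s t hs ht => simp only [map_add, TensorProduct.add_tmul, hs, ht]
    | tmul c d => simp [dualTensorHom_apply, TensorProduct.smul_tmul]

/-- Under `H^* ⊗ H ⊗ H ≅ Hom(H, H ⊗ H)`, quasi-coassociativity of the coaction is the conjunction of
the compatibilities of `U` and of `V` with `φ`. -/
theorem dualCoactionHom_coassoc (ψ : Module.Dual k H) :
    tensorLeft (H ⊗[k] H) A.dualLeftHom A.φ (TensorProduct.assoc k (Module.Dual k H) H H
      (TensorProduct.map A.dualCoactionHom LinearMap.id (A.dualCoactionHom ψ))) =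
    tensorRight (H ⊗[k] H) A.dualRightHom A.φ
      (TensorProduct.map LinearMap.id A.comul.toLinearMap (A.dualCoactionHom ψ)) := by
  apply dualTensorHom_injective
  refine LinearMap.ext fun m => ?_
  have h0 : dualTensorHom k H H (A.dualCoactionHom ψ) = sliceRight ψ ∘ₗ A.comulBar :=
    LinearMap.ext fun m => A.dualTensorHom_dualCoactionHom ψ m
  have h1 : ∀ s, dualTensorHom k H (H ⊗[k] H) (tensorLeft (H ⊗[k] H) A.dualLeftHom s
      (TensorProduct.assoc k (Module.Dual k H) H H
      (TensorProduct.map A.dualCoactionHom LinearMap.id (A.dualCoactionHom ψ)))) m =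
      sliceThird ψ (sandwich (LinearMap.id) (((1 : H) ⊗ₜ[k] A.V) * A.comulSnd A.V)
        (A.comulSnd.toLinearMap ∘ₗ A.comul.toLinearMap ∘ₗ A.Sinv)
        (Algebra.TensorProduct.comm k H (H ⊗[k] (H ⊗[k] H)) (appendOne₃ k H s)) *
        (A.comulSnd (A.comul m * A.U) * ((1 : H) ⊗ₜ[k] A.U))) := by
    intro s
    induction s with
    | zero => simp
    | add s t hs ht => simp only [map_add, LinearMap.add_apply, add_mul, hs, ht]
    | tmul X u =>
      rw [dualTensorHom_tensorLeft, dualTensorHom_coaction_coaction, h0, map_sliceRight_comulBar,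
        ← sliceThird_appendOne_mul, comulBar_apply]
      simp [mul_assoc]
  have h2 : ∀ w : Module.Dual k H ⊗[k] H, ∀ n, dualTensorHom k H (H ⊗[k] H)
      (TensorProduct.map LinearMap.id A.comul.toLinearMap w) n =
      A.comul (dualTensorHom k H H w n) := by
    intro w n
    induction w with
    | zero => simp
    | add s t hs ht => simp only [map_add, LinearMap.add_apply, hs, ht]
    | tmul χ x => simp [dualTensorHom_apply]
  have h3 : ∀ s, dualTensorHom k H (H ⊗[k] H) (tensorRight (H ⊗[k] H) A.dualRightHom s
      (TensorProduct.map LinearMap.id A.comul.toLinearMap (A.dualCoactionHom ψ))) m =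
      sliceThird ψ (A.comulFst (A.V * A.comul m) *
        A.actS₃ (A.comulFst A.U) (appendOne₃ k H s)) := by
    intro s
    induction s with
    | zero => simp
    | add s t hs ht => simp only [map_add, LinearMap.add_apply, mul_add, hs, ht]
    | tmul X u =>
      rw [dualTensorHom_tensorRight, h2, dualTensorHom_dualCoactionHom, ← sliceThird_comulFst,
        ← sliceThird_mul_appendOne, comulBar_apply]
      simp [mul_assoc]
  have h4 := A.φinv_mul_comulSnd_twistFreeU
  rw [← U_eq] at h4
  rw [h1, h3, sandwich_appendOne_V, ← h4]
  congr 1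
  simp only [map_mul, mul_assoc]
  rw [← mul_assoc A.φinv, φinv_mul_comulSnd_comul]
  simp only [mul_assoc]

/-- The dual space of `H` as a quasi-Hopf bimodule. -/
def dualBimodule : A.Bimodule (Module.Dual k H) where
  left := A.dualLeftHom
  right := A.dualRightHom
  left_mul a b ψ := by ext m; simp [Sinv_mul, mul_assoc]
  left_one ψ := by ext m; simp
  right_mul a b ψ := by ext m; simp [S_mul, mul_assoc]
  right_one ψ := by ext m; simp
  left_right a b ψ := by ext m; simp [mul_assoc]
  coact := A.dualCoactionHom
  coact_left := A.dualCoactionHom_left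
  coact_right := A.dualCoactionHom_right
  counit_coact := A.rid_map_counit_dualCoactionHom
  coassoc := A.dualCoactionHom_coassoc

/-- The map `E` of `H^*` is the projection of the bimodule `H^*`. -/
theorem coinvProj_eq (ψ : Module.Dual k H) : A.coinvProj ψ = A.dualBimodule.proj ψ := by
  rw [Bimodule.proj_apply, coinvProj]
  generalize A.qR = t
  induction t with
  | zero => simp
  | add s t hs ht => simp only [map_add, LinearMap.add_apply, hs, ht]
  | tmul a b =>
    change A.coinvAux a b (A.dualCoaction ψ) =
      A.dualBimodule.projAux (a ⊗ₜ b) (A.dualCoaction ψ)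
    generalize A.dualCoaction ψ = w
    induction w with
    | zero => simp
    | add s t hs ht => simp only [map_add, hs, ht]
    | tmul χ x => rw [Bimodule.projAux_tmul]; rfl

/-! ### Cointegrals, integrals and Frobenius bases -/

variable {A}

/-- A right integral does not see the projection `E`: `E(χ)(r) = χ(r)`. -/
theorem IsRightIntegral.proj_apply {r : H} (hr : A.IsRightIntegral r) (χ : Module.Dual k H) :
    A.dualBimodule.proj χ r = χ r := by
  have h : ∀ t w, A.dualBimodule.projAux t w r =
      A.counit A.β * A.dualLeftHom (A.counitSnd t) (TensorProduct.rid k (Module.Dual k H)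
        (TensorProduct.map LinearMap.id A.counit.toLinearMap w)) r := by
    intro t w
    induction w with
    | zero => simp
    | add w w' h h' => simp only [map_add, LinearMap.add_apply, mul_add, h, h']
    | tmul n x =>
      induction t with
      | zero => simp
      | add t t' h h' =>
        rw [map_add, LinearMap.add_apply, LinearMap.add_apply, map_add, h, h', map_add,
          LinearMap.add_apply, LinearMap.add_apply, mul_add]
      | tmul a b =>
        rw [Bimodule.projAux_tmul]
        change n (A.Sinv a * (r * A.S (A.β * A.S (b * x)))) = _
        rw [hr]
        simp [counit_S]
        ring
  have h1 := A.dualBimodule.counit_coact χ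
  rw [Bimodule.proj_apply, h, h1, counitSnd_qR]
  simp only [map_smul, LinearMap.smul_apply, smul_eq_mul, ← mul_assoc]
  rw [mul_comm (A.counit A.β), counit_α_mul_counit_β, one_mul]
  simp [dualLeftHom_apply]

section Cointegral

variable {lam : Module.Dual k H}

/-- `E(n₀) ⊗ n₁ = λ ⊗ a` for `n = λ · a = F_λ(a)`. -/
theorem IsLeftCointegral.projCoact_fourier (hlam : A.IsLeftCointegral lam) (a : H) :
    A.dualBimodule.projCoact (A.fourier lam a) = lam ⊗ₜ a := by
  obtain ⟨m, rfl⟩ := hlam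
  change A.dualBimodule.projCoact (A.dualBimodule.right a (A.coinvProj m)) = _
  rw [Bimodule.projCoact_right, coinvProj_eq, Bimodule.projCoact_proj]
  simp

theorem IsLeftCointegral.fourier_injective (hlam : A.IsLeftCointegral lam) (h0 : lam ≠ 0) :
    Function.Injective (A.fourier lam) := by
  intro a b hab
  have h := hlam.projCoact_fourier a
  rw [hab, hlam.projCoact_fourier] at h
  obtain ⟨m, hm⟩ : ∃ m, lam m ≠ 0 := by
    by_contra! hc
    exact h0 (LinearMap.ext hc)
  have := congrArg (fun w => dualTensorHom k H H w m) h
  simp only [dualTensorHom_apply] at this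
  exact (smul_right_injective H hm this).symm

theorem IsLeftCointegral.fourier_surjective (hlam : A.IsLeftCointegral lam) (h0 : lam ≠ 0) :
    Function.Surjective (A.fourier lam) :=
  (LinearMap.injective_iff_surjective_of_finrank_eq_finrank
    (f := A.dualBimodule.right.flip lam) Subspace.dual_finrank_eq.symm).1
    (hlam.fourier_injective h0)

/-- The map `x ↦ λ(x ·)` is injective since the functionals `F_λ(a) = λ(· S(a))` fill the dual, and
bijective by dimension. -/
theorem IsLeftCointegral.comp_mulLeft_bijective (hlam : A.IsLeftCointegral lam) (h0 : lam ≠ 0) :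
    Function.Bijective (fun x : H => lam ∘ₗ LinearMap.mulLeft k x) := by
  let F : H →ₗ[k] Module.Dual k H := LinearMap.mk₂ k (fun x y => lam (x * y))
    (by simp [add_mul]) (by simp) (by simp [mul_add]) (by simp)
  have hF : Function.Injective F := by
    rw [injective_iff_map_eq_zero]
    intro x hx
    rw [← Module.forall_dual_apply_eq_zero_iff k]
    intro ψ
    obtain ⟨a, rfl⟩ := hlam.fourier_surjective h0 ψ
    exact LinearMap.congr_fun hx (A.S a)
  exact ⟨hF, (LinearMap.injective_iff_surjective_of_finrank_eq_finrank
    Subspace.dual_finrank_eq.symm).1 hF⟩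

/-- The integral is the element `r` with `λ(r ·) = ε`. -/
theorem IsLeftCointegral.existsUnique_integral (hlam : A.IsLeftCointegral lam) (h0 : lam ≠ 0) :
    ∃! r : H, A.IsRightIntegral r ∧ lam r = 1 := by
  obtain ⟨hi, hs⟩ := hlam.comp_mulLeft_bijective h0
  obtain ⟨r, hr⟩ := hs A.counit.toLinearMap
  have hr' : ∀ b, lam (r * b) = A.counit b := fun b => LinearMap.congr_fun hr b
  refine ⟨r, ⟨fun a => hi ?_, ?_⟩, fun r' ⟨h1, h2⟩ => hi ?_⟩
  · ext b
    simp [hr']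
  · simpa using hr' 1
  · ext b
    simp [hr', h1 b, h2]

variable {r : H}

/-- The coinvariants are spanned by `λ`: `E(χ) = χ(r) λ`. -/
theorem IsLeftCointegral.proj_eq_smul (hlam : A.IsLeftCointegral lam) (hr : A.IsRightIntegral r)
    (hr1 : lam r = 1) (χ : Module.Dual k H) : A.dualBimodule.proj χ = χ r • lam := by
  have h0 : lam ≠ 0 := by
    rintro rfl
    simp at hr1
  -- If `E(χ) = λ · a`, then `λ ⊗ a = E(χ) ⊗ 1`; evaluate the first factor at `r`.
  obtain ⟨a, ha⟩ := hlam.fourier_surjective h0 (A.dualBimodule.proj χ)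
  have h := A.dualBimodule.projCoact_proj χ
  rw [← ha, hlam.projCoact_fourier, ha] at h
  have := congrArg (fun w => dualTensorHom k H H w r) h
  simp only [dualTensorHom_apply, hr1, one_smul, hr.proj_apply] at this
  rw [← ha, this]
  ext b
  simp [fourier, S_one]

/-- `ψ = E(ψ₀) · ψ₁ = λ · (ψ₀(r) ψ₁)`. -/
theorem IsLeftCointegral.fourier_rightInverse (hlam : A.IsLeftCointegral lam)
    (hr : A.IsRightIntegral r) (hr1 : lam r = 1) :
    Function.RightInverse (fun ψ : Module.Dual k H => sliceRight ψ (A.comulBar r))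
      (A.fourier lam) := by
  intro ψ
  have h : ∀ w, A.dualBimodule.rightMap
      (TensorProduct.map A.dualBimodule.proj LinearMap.id w) =
      A.fourier lam (dualTensorHom k H H w r) := by
    intro w
    change _ = A.dualBimodule.right.flip lam _
    induction w with
    | zero => simp
    | add w w' h h' => simp only [map_add, LinearMap.add_apply, h, h']
    | tmul χ x => simp [hlam.proj_eq_smul hr hr1, dualTensorHom_apply]
  have h1 := A.dualBimodule.rightMap_proj_coact ψ
  rw [h] at h1
  change A.fourier lam (dualTensorHom k H H (A.dualCoactionHom ψ) r) = ψ at h1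
  rwa [dualTensorHom_dualCoactionHom] at h1

theorem IsLeftCointegral.fourier_leftInverse (hlam : A.IsLeftCointegral lam)
    (hr : A.IsRightIntegral r) (hr1 : lam r = 1) :
    Function.LeftInverse (fun ψ : Module.Dual k H => sliceRight ψ (A.comulBar r))
      (A.fourier lam) := by
  refine Function.RightInverse.leftInverse_of_injective (hlam.fourier_rightInverse hr hr1)
    (hlam.fourier_injective ?_)
  rintro rfl
  simp at hr1

theorem IsLeftCointegral.isFrobeniusBasis (hlam : A.IsLeftCointegral lam)
    (hr : A.IsRightIntegral r) (hr1 : lam r = 1) :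
    IsFrobeniusBasis lam (TensorProduct.map A.S LinearMap.id (A.comulBar r)) := by
  intro a
  constructor
  -- Apply a functional `ψ` and use that the reconstruction of `ψ` from `r` takes the value `ψ(a)`.
  · rw [← sub_eq_zero, ← Module.forall_dual_apply_eq_zero_iff k]
    intro ψ
    rw [map_sub, sub_eq_zero]
    have h := LinearMap.congr_fun (hlam.fourier_rightInverse hr hr1 ψ) a
    rw [← h]
    dsimp only [fourier, LinearMap.comp_apply, LinearMap.mulRight_apply]
    generalize A.comulBar r = t
    induction t with
    | zero => simp
    | add s t hs ht => simp only [map_add, mul_add, hs, ht]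
    | tmul c d => simp [mul_comm]
  -- For `a = S(b)` this is `S` applied to the recovery of `b` from `F_λ(b)`.
  · obtain ⟨b, rfl⟩ := A.antipode.surjective a
    change _ = A.S b
    conv_rhs => rw [← hlam.fourier_leftInverse hr hr1 b]
    dsimp only [fourier]
    generalize A.comulBar r = t
    induction t with
    | zero => simp
    | add s t hs ht => simp only [map_add, hs, ht]
    | tmul c d =>
      simp only [TensorProduct.map_tmul, sliceRight_tmul, map_smul, LinearMap.id_apply]
      rfl

/-- An element of `H ⊗ H` is determined by its slices along the functionals `λ(x ·)`. -/
theorem IsLeftCointegral.eq_of_sliceLeft (hlam : A.IsLeftCointegral lam) (h0 : lam ≠ 0)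
    {s t : H ⊗[k] H} (h : ∀ a, sliceLeft (lam ∘ₗ LinearMap.mulLeft k a) s =
      sliceLeft (lam ∘ₗ LinearMap.mulLeft k a) t) : s = t := by
  have h1 : ∀ ψ : Module.Dual k H, sliceLeft ψ s = sliceLeft ψ t := by
    intro ψ
    obtain ⟨a, rfl⟩ := (hlam.comp_mulLeft_bijective h0).2 ψ
    exact h a
  have key : ∀ t : H ⊗[k] H, t = ∑ i, Module.finBasis k H i ⊗ₜ[k]
      sliceLeft ((Module.finBasis k H).coord i) t := by
    intro t
    induction t with
    | zero => simp
    | add s t hs ht =>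
      simp only [map_add, TensorProduct.tmul_add, Finset.sum_add_distrib, ← hs, ← ht]
    | tmul a b =>
      conv_lhs => rw [← (Module.finBasis k H).sum_repr a, TensorProduct.sum_tmul]
      simp [TensorProduct.smul_tmul]
  rw [key s, key t]
  simp only [h1]

theorem IsLeftCointegral.isFrobeniusBasis_iff (hlam : A.IsLeftCointegral lam)
    (hr : A.IsRightIntegral r) (hr1 : lam r = 1) (Q : H ⊗[k] H) :
    IsFrobeniusBasis lam Q ↔ Q = TensorProduct.map A.S LinearMap.id (A.comulBar r) := by
  have h := hlam.isFrobeniusBasis hr hr1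
  refine ⟨fun hQ => hlam.eq_of_sliceLeft ?_ fun a => (hQ a).1.trans (h a).1.symm, ?_⟩
  · rintro rfl
    simp at hr1
  · rintro rfl
    exact h

end Cointegral

end QuasiHopf

end

theorem proposition5 {k H : Type*} [Field k] [Ring H] [Algebra k H] [FiniteDimensional k H]
    (A : QuasiHopf k H) :
    IsUnit A.f ∧
    ∀ lam : Module.Dual k H, A.IsLeftCointegral lam → lam ≠ 0 →
      (∃! r : H, A.IsRightIntegral r ∧ lam r = 1) ∧
      ∀ r : H, A.IsRightIntegral r → lam r = 1 →
        Function.LeftInverse (fun ψ : Module.Dual k H => sliceRight ψ (A.comulBar r))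
          (A.fourier lam) ∧
        Function.RightInverse (fun ψ : Module.Dual k H => sliceRight ψ (A.comulBar r))
          (A.fourier lam) ∧
        ∀ Q : H ⊗[k] H, IsFrobeniusBasis lam Q ↔
          Q = TensorProduct.map A.S LinearMap.id (A.comulBar r) :=
  ⟨A.isUnit_f, fun _ hlam h0 => ⟨hlam.existsUnique_integral h0, fun _ hr hr1 =>
    ⟨hlam.fourier_leftInverse hr hr1, hlam.fourier_rightInverse hr hr1,
      hlam.isFrobeniusBasis_iff hr hr1⟩⟩⟩
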